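/- **Optimal inversion of an unknown unitary.** Let $d\ge 2$, let $\mathcal H_0,\dots,\mathcal H_3$ be copies of $\mathbb C^d$ with canonical basis, and let $dU$ be the Haar probability measure of $SU(d)$. For a matrix $A$ write $|A\rangle\!\rangle=\sum_{n,m}\langle n|A|m\rangle\,|n\rangle|m\rangle$, let $A^*$ be the entrywise complex conjugate, and let $P^\pm$ be the projectors onto the symmetric and antisymmetric subspaces of $\mathbb C^d\otimes\mathbb C^d$, $d_\pm=\operatorname{Tr}P^\pm$; subscripts indicate the factors acted upon. A *one-slot comb* is a positive operator $C$ on $\mathcal H_3\otimes\mathcal H_2\otimes\mathcal H_1\otimes\mathcal H_0$ with $\operatorname{Tr}_3C=I_2\otimes C^{(1)}$ and $\operatorname{Tr}_1C^{(1)}=I_0$ for some operator $C^{(1)}$. Inserting a unitary $U$ (a channel from wire $1$ to wire $2$) in the slot gives the channel from wire $0$ to wire $3$ with Choi operator $C*|U\rangle\!\rangle\langle\!\langle U|_{21}=\operatorname{Tr}_{21}\big[C^{\theta_{21}}(I_{30}\otimes|U\rangle\!\rangle\langle\!\langle U|_{21})\big]$, where $\theta_{21}$ is partial transposition. Let $$\overline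 F(C)=\int_{SU(d)}dU\; f\big(d^{-1}\,C*|U\rangle\!\rangle\langle\!\langle U|_{21},\;d^{-1}|U^\dagger\rangle\!\rangle\langle\!\langle U^\dagger|_{30}\big),\qquad f(\rho,\sigma)=\Big|\operatorname{Tr}\sqrt{\sqrt\sigma\,\rho\,\sqrt\sigma}\Big|^2 .$$ Call $C$ *covariant* if $[C,U_3\otimes W_2\otimes U_1\otimes W_0]=0$ for all $U,W\in SU(d)$, and let $\overline C=\int dU\,dW\,(U_3\otimes W_2\otimes U_1\otimes W_0)\,C\,(U_3\otimes W_2\otimes U_1\otimes W_0)^\dagger$. 1. The integrand of $\overline F(C)$ is integrable for every one-slot comb $C$, and the maximum of $\overline F$ over all one-slot combs is $2/d^2$. 2. For every one-slot comb $C$, $\overline C$ is a covariant one-slot comb and $\overline F(\overline C)=\overline F(C)$; so covariance may be assumed without loss of generality. Put $$C_{\rm opt}=\frac{P^+_{31}\otimes P^+_{20}}{d_+}+\frac{P^-_{31}\otimes P^-_{20}}{d_-}.$$ It is a covariant one-slot comb. A covariant one-slot comb $C$ satisfies $\overline F(C)=2/d^2$ if and only if $C=C_{\rm opt}$; an arbitrary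 one-slot comb $C$ satisfies $\overline F(C)=2/d^2$ if and only if $\overline C=C_{\rm opt}$. Moreover $$C_{\rm opt}=\int_{SU(d)}d\hat U\;|\hat U^\dagger\rangle\!\rangle\langle\!\langle\hat U^\dagger|_{30}\otimes|\hat U^*\rangle\!\rangle\langle\!\langle\hat U^*|_{21}.$$ 3. Write $C=C_{\rm opt}$, let $C^{(1)}=d^{-1}\operatorname{Tr}_{32}C$, let $T_{n\to m}$ identify wire $n$ with wire $m$, and let inverse square roots be taken on supports. Then $\operatorname{Tr}_3C=I_2\otimes C^{(1)}$ and $C^{(1)}=d^{-1}I_{10}$. The operators $V^{(1)}=(I_1\otimes C^{(1)*\frac12})|I\rangle\!\rangle_{11'}T_{0\to0'}$ and $V^{(2)}=\big(I_3\otimes C^{*\frac12}\,(I_{3'}\otimes I_{2'}\otimes C^{(1)*-\frac12})\big)|I\rangle\!\rangle_{33'}T_{2\to2'}$ equal $V^{(1)}=d^{-1/2}|I\rangle\!\rangle_{11'}\otimes T_{0\to0'}$ (preparation of a maximally entangled state while the input is stored) and $V^{(2)}=\sqrt d\,(I_3\otimes C^{*\frac12})|I\rangle\!\rangle_{33'}\otimes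 T_{2\to2'}$. They are isometries, from $\mathcal H_0$ to $\mathcal H_1\otimes\mathcal H_{1'0'}$ and from $\mathcal H_2\otimes\mathcal H_{1'0'}$ to $\mathcal H_3\otimes\mathcal H_{A_2}$, $\mathcal H_{A_2}=\operatorname{Supp}(C^*)\subseteq\mathcal H_{3'2'1'0'}$, and $C$ is the Choi operator of the network $\rho\mapsto\operatorname{Tr}_{A_2}[V^{(2)}V^{(1)}\rho V^{(1)\dagger}V^{(2)\dagger}]$ from $\mathcal H_2\otimes\mathcal H_0$ to $\mathcal H_3\otimes\mathcal H_1$. 4. $Q_{\hat U}=(C^*)^{-\frac12}\big(|\hat U^T\rangle\!\rangle\langle\!\langle\hat U^T|_{3'0'}\otimes|\hat U\rangle\!\rangle\langle\!\langle\hat U|_{2'1'}\big)(C^*)^{-\frac12}$ is a POVM on $\operatorname{Supp}(C^*)$ and $P_{\hat U}=d\,|\hat U\rangle\!\rangle\langle\!\langle\hat U|_{2'1'}$ is a POVM on $\mathcal H_{2'1'}$: both are positive, with Haar integrals the projector onto $\operatorname{Supp}(C^*)$ and $I_{2'1'}$, respectively. For every operator $\rho$, with wire $2$ identified with wire $2'$,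 the channel $\mathcal E(\rho)=\operatorname{Tr}_{A_2}[V^{(2)}\rho V^{(2)\dagger}]$ satisfies $$\mathcal E(\rho)=\int d\hat U\operatorname{Tr}_{A_2}\!\big[V^{(2)}\rho V^{(2)\dagger}(I_3\otimes Q_{\hat U})\big]=d\int d\hat U\;\hat U^\dagger\langle\!\langle\hat U|_{2'1'}\,\rho\,|\hat U\rangle\!\rangle_{2'1'}\hat U=\int d\hat U\;\hat U^\dagger\operatorname{Tr}_{2'1'}[(P_{\hat U}\otimes I_{0'})\rho]\,\hat U,$$ that is, $\mathcal E$ measures $P_{\hat U}$ on $\mathcal H_{2'1'}$ and applies $\hat U^\dagger$ to the stored input. Consequently, for every $U\in SU(d)$, the optimal comb with $U$ in its slot is the estimate-and-reprepare channel: $C*|U\rangle\!\rangle\langle\!\langle U|_{21}$ is the Choi operator of $$\rho\mapsto\int d\hat U\;\operatorname{Tr}\!\big[P_{\hat U}\,(U\otimes I)\,d^{-1}|I\rangle\!\rangle\langle\!\langle I|\,(U\otimes I)^\dagger\big]\;\hat U^\dagger\rho\,\hat U .$$ -/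

import Mathlib

open scoped MatrixOrder ComplexOrder Kronecker

noncomputable section

namespace UnitaryInversion

/-! ### The group `SU(d)` and its Haar probability measure -/

/-- The special unitary group `SU(d)`. -/
abbrev SU (d : ℕ) : Type := ↥(Matrix.specialUnitaryGroup (Fin d) ℂ)

instance instTopologicalGroupSU (d : ℕ) : IsTopologicalGroup (SU d) where
  continuous_mul := by
    refine Continuous.subtype_mk ?_ _
    exact (continuous_subtype_val.comp continuous_fst).mul
      (continuous_subtype_val.comp continuous_snd)
  continuous_inv := by
    refine Continuous.subtype_mk ?_ _
    exact continuous_subtype_val.star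

instance instCompactSpaceSU (d : ℕ) : CompactSpace (SU d) := by
  apply isCompact_iff_compactSpace.mp
  have hK : IsCompact (Set.univ.pi fun _ : Fin d =>
      Set.univ.pi fun _ : Fin d => Metric.closedBall (0 : ℂ) 1) :=
    isCompact_univ_pi fun _ => isCompact_univ_pi fun _ => isCompact_closedBall 0 1
  refine hK.of_isClosed_subset ?_ ?_
  · have h : (Matrix.specialUnitaryGroup (Fin d) ℂ : Set (Matrix (Fin d) (Fin d) ℂ)) =
        {A | A * star A = 1} ∩ {A | A.det = 1} := by
      ext A
      simp only [SetLike.mem_coe, Matrix.mem_specialUnitaryGroup_iff,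
        Matrix.mem_unitaryGroup_iff, Set.mem_inter_iff, Set.mem_ofPred_eq]
    rw [h]
    exact (isClosed_eq (continuous_id.mul continuous_id.star) continuous_const).inter
      (isClosed_eq (continuous_id.matrix_det) continuous_const)
  · intro A hA i _ j _
    have := entry_norm_bound_of_unitary
      (Matrix.specialUnitaryGroup_le_unitaryGroup hA) i j
    simpa using this

instance instMeasurableSpaceSU (d : ℕ) : MeasurableSpace (SU d) := borel _

instance instBorelSpaceSU (d : ℕ) : BorelSpace (SU d) := ⟨rfl⟩

/-- The Haar measure of the compact group `SU(d)`, normalized to total mass one. -/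
def haarSU (d : ℕ) : MeasureTheory.Measure (SU d) := MeasureTheory.Measure.haarMeasure ⊤

/-- The Haar integral of a matrix-valued function, entry by entry. -/
def haarAvg {d : ℕ} {m n : Type*} (f : SU d → Matrix m n ℂ) : Matrix m n ℂ :=
  Matrix.of fun i j => ∫ U, f U i j ∂(haarSU d)

/-! ### Linear algebra -/

section LinearAlgebra

variable {m n k : Type*}

/-- Entrywise complex conjugation `A ↦ A^*` in the canonical basis. -/
def conjM (A : Matrix m n ℂ) : Matrix m n ℂ := A.map star

/-- The vector `|A⟩⟩ = ∑ ⟨n|A|m⟩ |n⟩|m⟩`. -/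
def dket (A : Matrix m n ℂ) : m × n → ℂ := fun p => A p.1 p.2

/-- The operator `|A⟩⟩⟨⟨A|`. -/
def dproj (A : Matrix m n ℂ) : Matrix (m × n) (m × n) ℂ :=
  Matrix.vecMulVec (dket A) (star (dket A))

/-- Partial trace over the first tensor factor. -/
def traceLeft [Fintype m] (M : Matrix (m × n) (m × n) ℂ) : Matrix n n ℂ :=
  Matrix.of fun x y => ∑ i, M (i, x) (i, y)

/-- Partial trace over the second tensor factor. -/
def traceRight [Fintype n] (M : Matrix (m × n) (m × n) ℂ) : Matrix m m ℂ :=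
  Matrix.of fun x y => ∑ i, M (x, i) (y, i)

/-- Partial transposition of the second tensor factor. -/
def transposeRight (M : Matrix (m × n) (m × n) ℂ) : Matrix (m × n) (m × n) ℂ :=
  Matrix.of fun x y => M (x.1, y.2) (y.1, x.2)

/-- Link product `C * E = Tr_K[C^{θ_K} (I ⊗ E)]` of an operator `C` on `H ⊗ K` with an operator
`E` on `K`. -/
def link [Fintype m] [DecidableEq m] [Fintype n]
    (C : Matrix (m × n) (m × n) ℂ) (E : Matrix n n ℂ) : Matrix m m ℂ :=
  traceRight (transposeRight C * ((1 : Matrix m m ℂ) ⊗ₖ E))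

/-- The Choi-Jamiołkowski operator `(Φ ⊗ id)(|I⟩⟩⟨⟨I|) = ∑ Φ(|i⟩⟨j|) ⊗ |i⟩⟨j|`, the output space
being the first tensor factor. -/
def choi [Fintype m] [DecidableEq m] (Φ : Matrix m m ℂ → Matrix n n ℂ) :
    Matrix (n × m) (n × m) ℂ :=
  ∑ i, ∑ j, Φ (Matrix.single i j 1) ⊗ₖ Matrix.single i j (1 : ℂ)

variable [Fintype m] [DecidableEq m]

/-- `A^{-1/2}` for a positive `A`: inverse square root on the support, zero on the kernel. -/
def invSqrt (A : Matrix m m ℂ) : Matrix m m ℂ := cfc (fun x : ℝ => (Real.sqrt x)⁻¹) A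

/-- The orthogonal projector onto the support of a Hermitian `A`. -/
def suppProj (A : Matrix m m ℂ) : Matrix m m ℂ := cfc (fun x : ℝ => if x = 0 then 0 else 1) A

/-- State fidelity `f(ρ,σ) = |Tr √(√σ ρ √σ)|²`. -/
def stateFidelity (ρ σ : Matrix m m ℂ) : ℝ :=
  ‖(CFC.sqrt (CFC.sqrt σ * ρ * CFC.sqrt σ)).trace‖ ^ 2

end LinearAlgebra

/-! ### One-slot combs and the inversion task -/

/-- The labels of the canonical basis of `H_3 ⊗ H_2 ⊗ H_1 ⊗ H_0`, each factor being `ℂ^d`. The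
components of a tuple are listed in the order `3, 2, 1, 0`. -/
abbrev Wires (d : ℕ) : Type := Fin d × Fin d × Fin d × Fin d

/-- Regrouping of the wires `3210` as `(30)(21)`. -/
def group3021 (d : ℕ) : Wires d ≃ (Fin d × Fin d) × (Fin d × Fin d) where
  toFun w := ((w.1, w.2.2.2), (w.2.1, w.2.2.1))
  invFun p := (p.1.1, p.2.1, p.2.2, p.1.2)
  left_inv _ := rfl
  right_inv _ := rfl

/-- Regrouping of the wires `3210` as `(31)(20)`. -/
def group3120 (d : ℕ) : Wires d ≃ (Fin d × Fin d) × (Fin d × Fin d) where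
  toFun w := ((w.1, w.2.2.1), (w.2.1, w.2.2.2))
  invFun p := (p.1.1, p.2.1, p.1.2, p.2.2)
  left_inv _ := rfl
  right_inv _ := rfl

/-- `A_{30} ⊗ B_{21}` as an operator on `H_{3210}`. -/
def tensor3021 {d : ℕ} (A B : Matrix (Fin d × Fin d) (Fin d × Fin d) ℂ) :
    Matrix (Wires d) (Wires d) ℂ :=
  (A ⊗ₖ B).submatrix (group3021 d) (group3021 d)

/-- `A_{31} ⊗ B_{20}` as an operator on `H_{3210}`. -/
def tensor3120 {d : ℕ} (A B : Matrix (Fin d × Fin d) (Fin d × Fin d) ℂ) :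
    Matrix (Wires d) (Wires d) ℂ :=
  (A ⊗ₖ B).submatrix (group3120 d) (group3120 d)

/-- One-slot quantum combs: positive operators `C` on `H_{3210}` such that
`Tr_3 C = I_2 ⊗ C⁽¹⁾` and `Tr_1 C⁽¹⁾ = I_0` for some operator `C⁽¹⁾` on `H_{10}`. -/
def IsOneSlotComb {d : ℕ} (C : Matrix (Wires d) (Wires d) ℂ) : Prop :=
  C.PosSemidef ∧ ∃ C₁ : Matrix (Fin d × Fin d) (Fin d × Fin d) ℂ,
    traceLeft C = (1 : Matrix (Fin d) (Fin d) ℂ) ⊗ₖ C₁ ∧ traceLeft C₁ = 1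

/-- The Choi operator on `H_{30}` of the circuit obtained by inserting in the slot of `C` a
channel from wire `1` to wire `2` with Choi operator `E` on `H_{21}`. -/
def plug {d : ℕ} (C : Matrix (Wires d) (Wires d) ℂ)
    (E : Matrix (Fin d × Fin d) (Fin d × Fin d) ℂ) : Matrix (Fin d × Fin d) (Fin d × Fin d) ℂ :=
  link (C.submatrix (group3021 d).symm (group3021 d).symm) E

/-- Channel fidelity of two channels on `ℂ^d` with Choi operators `A` and `B`. -/
def channelFidelity {d : ℕ} (A B : Matrix (Fin d × Fin d) (Fin d × Fin d) ℂ) : ℝ :=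
  stateFidelity ((d : ℂ)⁻¹ • A) ((d : ℂ)⁻¹ • B)

/-- Fidelity between the channel obtained by inserting `U` in `C` and the channel of `U⁻¹ = U†`. -/
def inversionFidelity {d : ℕ} (C : Matrix (Wires d) (Wires d) ℂ) (U : SU d) : ℝ :=
  channelFidelity (plug C (dproj U.1)) (dproj U.1.conjTranspose)

/-- Average of the fidelity over the Haar measure of `SU(d)`. -/
def averageFidelity {d : ℕ} (C : Matrix (Wires d) (Wires d) ℂ) : ℝ :=
  ∫ U, inversionFidelity C U ∂(haarSU d)

/-- `U_3 ⊗ W_2 ⊗ U_1 ⊗ W_0`. -/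
def symmetryOp {d : ℕ} (U W : SU d) : Matrix (Wires d) (Wires d) ℂ :=
  U.1 ⊗ₖ (W.1 ⊗ₖ (U.1 ⊗ₖ W.1))

/-- `[C, U_3 ⊗ W_2 ⊗ U_1 ⊗ W_0] = 0` for all `U, W ∈ SU(d)`. -/
def IsCovariant {d : ℕ} (C : Matrix (Wires d) (Wires d) ℂ) : Prop :=
  ∀ U W : SU d, Commute C (symmetryOp U W)

/-- `∫ dU dW (U_3 ⊗ W_2 ⊗ U_1 ⊗ W_0) C (U_3 ⊗ W_2 ⊗ U_1 ⊗ W_0)†`. -/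
def twirl {d : ℕ} (C : Matrix (Wires d) (Wires d) ℂ) : Matrix (Wires d) (Wires d) ℂ :=
  haarAvg fun U : SU d => haarAvg fun W : SU d =>
    symmetryOp U W * C * (symmetryOp U W).conjTranspose

/-! ### The optimal comb -/

/-- The swap operator on `ℂ^d ⊗ ℂ^d`. -/
def swapOp (d : ℕ) : Matrix (Fin d × Fin d) (Fin d × Fin d) ℂ :=
  Matrix.of fun x y => if x.1 = y.2 ∧ x.2 = y.1 then 1 else 0

/-- The projector onto the symmetric subspace of `ℂ^d ⊗ ℂ^d`. -/
def projSym (d : ℕ) : Matrix (Fin d × Fin d) (Fin d × Fin d) ℂ := (1 / 2 : ℂ) • (1 + swapOp d)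

/-- The projector onto the antisymmetric subspace of `ℂ^d ⊗ ℂ^d`. -/
def projAnti (d : ℕ) : Matrix (Fin d × Fin d) (Fin d × Fin d) ℂ := (1 / 2 : ℂ) • (1 - swapOp d)

/-- `P⁺_{31} ⊗ P⁺_{20} / d₊ + P⁻_{31} ⊗ P⁻_{20} / d₋` with `d_± = Tr P^±`. -/
def optimalComb (d : ℕ) : Matrix (Wires d) (Wires d) ℂ :=
  (projSym d).trace⁻¹ • tensor3120 (projSym d) (projSym d) +
    (projAnti d).trace⁻¹ • tensor3120 (projAnti d) (projAnti d)

/-! ### Realization of the optimal comb by isometries -/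

/-- The comb `C⁽¹⁾` on `H_{10}` of the first tooth of a one-slot comb: `d⁻¹ Tr_{32} C`. -/
def reducedComb {d : ℕ} (C : Matrix (Wires d) (Wires d) ℂ) :
    Matrix (Fin d × Fin d) (Fin d × Fin d) ℂ :=
  (d : ℂ)⁻¹ • traceLeft (traceLeft C)

/-- The operator `|I⟩⟩_{oo'} ⊗ T_{s → s'}` from `H_s` to `H_o ⊗ (H_{o'} ⊗ H_{s'})`. -/
def copyKet (o s : Type*) [DecidableEq o] [DecidableEq s] : Matrix (o × (o × s)) s ℂ :=
  Matrix.of fun x y => if x.1 = x.2.1 ∧ x.2.2 = y then 1 else 0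

/-- The minimal isometry of a tooth of a comb,
`V = (I_o ⊗ D^{*1/2} N^{*-1/2}) |I⟩⟩_{oo'} T_{s → s'}`, from `H_s` to `H_o ⊗ H_{A}`, where the new
ancilla `H_A = Supp(D^*)` is a subspace of `H_{o'} ⊗ H_{s'}`. Here `o` is the output wire of the
tooth, `s` consists of its input wire and of the wires carrying the previous ancilla, `D` is the
comb up to this tooth and `N = Tr_o D` is the identity on the input wire tensored with the comb up
to the previous tooth. -/
def toothIsometry {o s : Type*} [Fintype o] [DecidableEq o] [Fintype s] [DecidableEq s]
    (D : Matrix (o × s) (o × s) ℂ) (N : Matrix s s ℂ) : Matrix (o × (o × s)) s ℂ :=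
  ((1 : Matrix o o ℂ) ⊗ₖ
    (CFC.sqrt (conjM D) * ((1 : Matrix o o ℂ) ⊗ₖ invSqrt (conjM N)))) * copyKet o s

/-- First isometry `V⁽¹⁾ : H_0 → H_1 ⊗ H_{1'0'}` of the optimal comb. -/
def isometryOne (d : ℕ) : Matrix (Fin d × (Fin d × Fin d)) (Fin d) ℂ :=
  toothIsometry (reducedComb (optimalComb d)) 1

/-- Second isometry `V⁽²⁾ : H_2 ⊗ H_{1'0'} → H_3 ⊗ H_{3'2'1'0'}` of the optimal comb. -/
def isometryTwo (d : ℕ) : Matrix (Fin d × Wires d) (Fin d × (Fin d × Fin d)) ℂ :=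
  toothIsometry (optimalComb d) ((1 : Matrix (Fin d) (Fin d) ℂ) ⊗ₖ reducedComb (optimalComb d))

/-- The concatenation `V⁽²⁾ V⁽¹⁾ : H_2 ⊗ H_0 → (H_3 ⊗ H_1) ⊗ H_{A_2}`, where `V⁽¹⁾` maps `H_0` to
`H_1 ⊗ H_{A_1}` and `V⁽²⁾` maps `H_2 ⊗ H_{A_1}` to `H_3 ⊗ H_{A_2}`. -/
def concat {d : ℕ} {a b : Type*} [Fintype a]
    (V₂ : Matrix (Fin d × b) (Fin d × a) ℂ) (V₁ : Matrix (Fin d × a) (Fin d) ℂ) :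
    Matrix ((Fin d × Fin d) × b) (Fin d × Fin d) ℂ :=
  Matrix.of fun x y => ∑ q, V₂ (x.1.1, x.2) (y.1, q) * V₁ (x.1.2, q) y.2

/-- The map `ρ ↦ Tr_A[V ρ V†]` for `V : H → K ⊗ H_A`. -/
def dilated {m n a : Type*} [Fintype m] [Fintype a] (V : Matrix (n × a) m ℂ)
    (ρ : Matrix m m ℂ) : Matrix n n ℂ :=
  traceRight (V * ρ * V.conjTranspose)

/-! ### The estimate-and-reprepare strategy -/

/-- The POVM density `Q_U = (C^*)^{-1/2} (|U^T⟩⟩⟨⟨U^T|_{3'0'} ⊗ |U⟩⟩⟨⟨U|_{2'1'}) (C^*)^{-1/2}` for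
the optimal comb `C`. -/
def ancillaPOVM {d : ℕ} (U : SU d) : Matrix (Wires d) (Wires d) ℂ :=
  invSqrt (conjM (optimalComb d)) * tensor3021 (dproj U.1.transpose) (dproj U.1) *
    invSqrt (conjM (optimalComb d))

/-- The POVM density `P_U = d |U⟩⟩⟨⟨U|` on `H_{2'1'}`. -/
def estimationPOVM {d : ℕ} (U : SU d) : Matrix (Fin d × Fin d) (Fin d × Fin d) ℂ :=
  (d : ℂ) • dproj U.1

/-- The operator `|U⟩⟩_{2'1'} ⊗ I_{0'}` from `H_{0'}` to `H_{2'1'0'}`. -/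
def dketTensorId {d : ℕ} (U : SU d) : Matrix (Fin d × (Fin d × Fin d)) (Fin d) ℂ :=
  Matrix.of fun x y => dket U.1 (x.1, x.2.1) * (1 : Matrix (Fin d) (Fin d) ℂ) x.2.2 y

/-- Measure the POVM `P_U` on `H_{2'1'}` and, on outcome `U`, apply `U†` to `H_{0'}`:
`ρ ↦ ∫ dU U† Tr_{2'1'}[(P_U ⊗ I_{0'}) ρ] U`. -/
def measureAndReprepare {d : ℕ}
    (ρ : Matrix (Fin d × (Fin d × Fin d)) (Fin d × (Fin d × Fin d)) ℂ) :
    Matrix (Fin d) (Fin d) ℂ :=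
  haarAvg fun U : SU d =>
    U.1.conjTranspose *
      traceLeft (traceLeft
        ((estimationPOVM U ⊗ₖ (1 : Matrix (Fin d) (Fin d) ℂ)).submatrix
          (Equiv.prodAssoc (Fin d) (Fin d) (Fin d)).symm
          (Equiv.prodAssoc (Fin d) (Fin d) (Fin d)).symm * ρ)) *
      U.1

/-- The maximally entangled state `d⁻¹ |I⟩⟩⟨⟨I|` of `H_{11'}` after `U` has been applied to its
first factor. -/
def probeAfter {d : ℕ} (U : SU d) : Matrix (Fin d × Fin d) (Fin d × Fin d) ℂ :=
  (U.1 ⊗ₖ (1 : Matrix (Fin d) (Fin d) ℂ)) *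
    ((d : ℂ)⁻¹ • dproj (1 : Matrix (Fin d) (Fin d) ℂ)) *
    (U.1 ⊗ₖ (1 : Matrix (Fin d) (Fin d) ℂ)).conjTranspose

/-- The estimate-and-reprepare strategy with the unitary `U` in the slot: the estimate `Û` is
obtained by measuring the POVM `P_Û` on the probe, and `Û†` is applied to the stored input. -/
def estimateAndReprepare {d : ℕ} (U : SU d) (ρ : Matrix (Fin d) (Fin d) ℂ) :
    Matrix (Fin d) (Fin d) ℂ :=
  haarAvg fun V : SU d =>
    (estimationPOVM V * probeAfter U).trace • (V.1.conjTranspose * ρ * V.1)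

end UnitaryInversion

end

open UnitaryInversion

namespace UnitaryInversion

open Matrix MeasureTheory

/-! The target state `d⁻¹ |U†⟩⟩⟨⟨U†|` is pure, so the fidelity is a linear functional of the comb:
it equals `d⁻² Tr[C Ω_U]` with `Ω_U = |U†⟩⟩⟨⟨U†|_{30} ⊗ |U^*⟩⟩⟨⟨U^*|_{21}` (`inversionFidelity_eq`).
The average fidelity is therefore `d⁻² Tr[C Ω]` with `Ω = ∫ Ω_U dU`. Conjugation by `V_3 ⊗ W_2 ⊗ V_1
⊗ W_0` moves `Ω_U` to the operator of `W^* U V⁻¹`, so `Ω` is covariant by the two-sided invariance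
of the Haar measure, and twirling `C` does not change `Tr[C Ω]` (`trace_twirl_mul`).

An operator commuting with every `U ⊗ U` is a combination of the identity and the swap
(`eq_add_swapOp_of_commute`). Applied to the pairs of wires `31` and `20`, this gives every
covariant operator four coefficients `x, y, z, t` (`IsCovariant.exists_eq_permComb`). For `Ω`, a
symmetry of its integrand and its partial traces fix all four, and the result is `optimalComb`
(`haarAvg_combProj`).

For a covariant comb the normalization conditions express `y` and `t` through `x` and `z`, and the
average fidelity becomes `(1 - d(d²-1) z)/d²`. Positivity on the symmetric-antisymmetric and
antisymmetric-symmetric sectors gives two linear inequalities. Together they imply `d(d²-1) z ≥ -1`,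
with equality only if both are tight, which leaves a single comb (`covariant_comb_coeff`).

The formula `optimalComb = Ω` also gives the realization. The amplitudes of both the second isometry
and the whole network are entries of the square root of `C^*`, so tracing out the ancilla returns
entries of `C^*`. Writing `C^*` as the Haar integral of rank-one operators turns each resulting
expression into an average over estimates. -/

lemma entry_eq {m n : Type*} {M N : Matrix m n ℂ} (h : M = N) (i : m) (j : n) :
    M i j = N i j := by rw [h]

/-! ### Entries of products with a tensor factor equal to the identity -/

section TensorEntries

variable {m n : Type*} [Fintype m] [Fintype n]

lemma mul_kronecker_one_apply [DecidableEq n] (M : Matrix (m × n) (m × n) ℂ) (X : Matrix m m ℂ) (i j : m)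
    (p q : n) : (M * (X ⊗ₖ (1 : Matrix n n ℂ))) (i, p) (j, q) =
      ∑ u, M (i, p) (u, q) * X u j := by
  simp [mul_apply, Fintype.sum_prod_type, one_apply]

lemma kronecker_one_mul_apply [DecidableEq n] (M : Matrix (m × n) (m × n) ℂ) (X : Matrix m m ℂ) (i j : m)
    (p q : n) : ((X ⊗ₖ (1 : Matrix n n ℂ)) * M) (i, p) (j, q) =
      ∑ u, X i u * M (u, p) (j, q) := by
  simp [mul_apply, Fintype.sum_prod_type, one_apply]

lemma mul_one_kronecker_apply [DecidableEq m] (M : Matrix (m × n) (m × n) ℂ) (X : Matrix n n ℂ) (i j : m)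
    (p q : n) : (M * ((1 : Matrix m m ℂ) ⊗ₖ X)) (i, p) (j, q) =
      ∑ u, M (i, p) (j, u) * X u q := by
  simp [mul_apply, Fintype.sum_prod_type_right, one_apply]

lemma one_kronecker_mul_apply [DecidableEq m] (M : Matrix (m × n) (m × n) ℂ) (X : Matrix n n ℂ) (i j : m)
    (p q : n) : (((1 : Matrix m m ℂ) ⊗ₖ X) * M) (i, p) (j, q) =
      ∑ u, X p u * M (i, u) (j, q) := by
  simp [mul_apply, Fintype.sum_prod_type_right, one_apply]

end TensorEntries

/-! ### The commutant of `U ⊗ U` -/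

section Commutant

variable {d : ℕ}

/-- A unitary becomes special after multiplication by a scalar, and scalars do not affect
commutation. This removes the trace condition on the generators used below. -/
lemma commute_kronecker_of_mem_unitaryGroup (hd : d ≠ 0)
    {M : Matrix (Fin d × Fin d) (Fin d × Fin d) ℂ}
    (hM : ∀ U : SU d, Commute M (U.1 ⊗ₖ U.1)) {U : Matrix (Fin d) (Fin d) ℂ}
    (hU : U ∈ unitaryGroup (Fin d) ℂ) : Commute M (U ⊗ₖ U) := by
  have hdet : ‖U.det‖ = 1 := by
    have h := congrArg Matrix.det (mem_unitaryGroup_iff.mp hU)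
    rw [det_mul, star_eq_conjTranspose, det_conjTranspose, det_one] at h
    have h2 := congrArg norm h
    rw [norm_mul, norm_star, norm_one] at h2
    nlinarith [norm_nonneg U.det]
  -- A `d`-th root of `det⁻¹` normalizes the determinant of `z • U`; it has modulus one because `det
  -- U` has.
  obtain ⟨z, hz⟩ := IsAlgClosed.exists_pow_nat_eq (U.det)⁻¹ (Nat.pos_of_ne_zero hd)
  have hz1 : ‖z‖ = 1 := by
    have h := congrArg norm hz
    rw [norm_pow, norm_inv, hdet, inv_one] at h
    exact (pow_eq_one_iff_of_nonneg (norm_nonneg z) hd).mp h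
  have hz0 : z ≠ 0 := by
    intro h
    simp [h] at hz1
  have hzz : z * star z = 1 := by
    have := Complex.mul_conj z
    rw [Complex.normSq_eq_norm_sq, hz1] at this
    simpa using this
  have hdet0 : U.det ≠ 0 := by
    intro h
    simp [h] at hdet
  have hmem : z • U ∈ specialUnitaryGroup (Fin d) ℂ := by
    rw [mem_specialUnitaryGroup_iff, mem_unitaryGroup_iff]
    refine ⟨?_, ?_⟩
    · rw [star_smul, smul_mul_smul_comm, hzz, mem_unitaryGroup_iff.mp hU, one_smul]
    · rw [det_smul, Fintype.card_fin, hz, inv_mul_cancel₀ hdet0]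
  have h := hM ⟨z • U, hmem⟩
  simp only [smul_kronecker, kronecker_smul] at h
  have h2 := (h.smul_right z⁻¹).smul_right z⁻¹
  simpa only [smul_smul, ← mul_assoc, inv_mul_cancel₀ hz0, one_mul, one_smul] using
    (by simpa [smul_smul, hz0, mul_assoc] using h2 : Commute M (U ⊗ₖ U))

section Derivative

attribute [local instance] Matrix.linftyOpNormedRing Matrix.linftyOpNormedAlgebra

lemma hasDerivAt_exp_smul_apply (A : Matrix (Fin d) (Fin d) ℂ) (i j : Fin d) :
    HasDerivAt (fun t : ℝ => NormedSpace.exp (t • A) i j) (A i j) 0 := by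
  have h := hasDerivAt_exp_smul_const (𝕂 := ℝ) A (0 : ℝ)
  rw [zero_smul, NormedSpace.exp_zero, one_mul] at h
  exact (hasDerivAt_pi.mp (hasDerivAt_pi.mp h i) j)

end Derivative

lemma exp_zero_smul_apply (A : Matrix (Fin d) (Fin d) ℂ) :
    NormedSpace.exp ((0 : ℝ) • A) = 1 := by
  rw [zero_smul, NormedSpace.exp_zero]

lemma exp_smul_mem_unitaryGroup {A : Matrix (Fin d) (Fin d) ℂ} (hA : Aᴴ = -A) (t : ℝ) :
    NormedSpace.exp (t • A) ∈ unitaryGroup (Fin d) ℂ := by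
  rw [mem_unitaryGroup_iff, star_eq_conjTranspose, ← exp_conjTranspose, conjTranspose_smul, hA,
    ← exp_add_of_commute]
  · simp
  · simp only [star_trivial, smul_neg]
    exact (Commute.refl _).neg_right

/-- Both sides of `M (e^{tA} ⊗ e^{tA}) = (e^{tA} ⊗ e^{tA}) M` are differentiated entrywise at `t =
0`. -/
lemma commute_kroneckerSum_of_skew (hd : d ≠ 0)
    {M : Matrix (Fin d × Fin d) (Fin d × Fin d) ℂ}
    (hM : ∀ U : SU d, Commute M (U.1 ⊗ₖ U.1)) {A : Matrix (Fin d) (Fin d) ℂ}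
    (hA : Aᴴ = -A) :
    Commute M (A ⊗ₖ (1 : Matrix (Fin d) (Fin d) ℂ) + (1 : Matrix (Fin d) (Fin d) ℂ) ⊗ₖ A) := by
  have key : ∀ p q : Fin d × Fin d, HasDerivAt
      (fun t : ℝ => (NormedSpace.exp (t • A) ⊗ₖ NormedSpace.exp (t • A)) p q)
      ((A ⊗ₖ (1 : Matrix (Fin d) (Fin d) ℂ) + (1 : Matrix (Fin d) (Fin d) ℂ) ⊗ₖ A) p q) 0 := by
    intro p q
    have h := (hasDerivAt_exp_smul_apply A p.1 q.1).mul (hasDerivAt_exp_smul_apply A p.2 q.2)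
    rw [exp_zero_smul_apply] at h
    exact h
  ext p q
  have h1 : HasDerivAt (fun t : ℝ =>
      (M * (NormedSpace.exp (t • A) ⊗ₖ NormedSpace.exp (t • A))) p q)
      ((M * (A ⊗ₖ (1 : Matrix (Fin d) (Fin d) ℂ) + (1 : Matrix (Fin d) (Fin d) ℂ) ⊗ₖ A)) p q) 0 := by
    simp only [mul_apply]
    exact HasDerivAt.fun_sum fun r _ => (key r q).const_mul (M p r)
  have h2 : HasDerivAt (fun t : ℝ =>
      ((NormedSpace.exp (t • A) ⊗ₖ NormedSpace.exp (t • A)) * M) p q)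
      (((A ⊗ₖ (1 : Matrix (Fin d) (Fin d) ℂ) + (1 : Matrix (Fin d) (Fin d) ℂ) ⊗ₖ A) * M) p q) 0 := by
    simp only [mul_apply]
    exact HasDerivAt.fun_sum fun r _ => (key p r).mul_const (M r q)
  refine h1.unique (h2.congr_of_eventuallyEq (Filter.Eventually.of_forall fun t => ?_))
  exact entry_eq
    (commute_kronecker_of_mem_unitaryGroup hd hM (exp_smul_mem_unitaryGroup hA t)).eq p q

/-- The condition is complex linear in `X`, and the skew-Hermitian matrices span all matrices over
`ℂ`: `X = ½(X - X†) - (i/2) · i(X + X†)`. -/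
lemma commute_kroneckerSum (hd : d ≠ 0) {M : Matrix (Fin d × Fin d) (Fin d × Fin d) ℂ}
    (hM : ∀ U : SU d, Commute M (U.1 ⊗ₖ U.1)) (X : Matrix (Fin d) (Fin d) ℂ) :
    Commute M (X ⊗ₖ (1 : Matrix (Fin d) (Fin d) ℂ) + (1 : Matrix (Fin d) (Fin d) ℂ) ⊗ₖ X) := by
  have h1 := commute_kroneckerSum_of_skew hd hM (A := X - Xᴴ) (by simp)
  have h2 := commute_kroneckerSum_of_skew hd hM (A := Complex.I • (X + Xᴴ)) (by
    simp [conjTranspose_smul, add_comm])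
  have h3 := (h1.smul_right (1 / 2 : ℂ)).add_right (h2.smul_right (-Complex.I / 2))
  have e : X ⊗ₖ (1 : Matrix (Fin d) (Fin d) ℂ) + (1 : Matrix (Fin d) (Fin d) ℂ) ⊗ₖ X =
      (1 / 2 : ℂ) • ((X - Xᴴ) ⊗ₖ (1 : Matrix (Fin d) (Fin d) ℂ) +
        (1 : Matrix (Fin d) (Fin d) ℂ) ⊗ₖ (X - Xᴴ)) + (-Complex.I / 2) •
      ((Complex.I • (X + Xᴴ)) ⊗ₖ (1 : Matrix (Fin d) (Fin d) ℂ) +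
        (1 : Matrix (Fin d) (Fin d) ℂ) ⊗ₖ (Complex.I • (X + Xᴴ))) := by
    ext p q
    simp only [Matrix.add_apply, kroneckerMap_apply, Matrix.smul_apply, Matrix.sub_apply,
      smul_eq_mul]
    linear_combination (1 / 2 : ℂ) * (((X p.1 q.1 + Xᴴ p.1 q.1) *
      (1 : Matrix (Fin d) (Fin d) ℂ) p.2 q.2) + (X p.2 q.2 + Xᴴ p.2 q.2) *
      (1 : Matrix (Fin d) (Fin d) ℂ) p.1 q.1) * Complex.I_sq
  rw [e]
  exact h3

/-- The product of the generators of `X` and of `Y`, minus the generator of `X * Y`, leaves exactly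
the mixed terms. -/
lemma commute_kronecker_symm (hd : d ≠ 0) {M : Matrix (Fin d × Fin d) (Fin d × Fin d) ℂ}
    (hM : ∀ U : SU d, Commute M (U.1 ⊗ₖ U.1)) (X Y : Matrix (Fin d) (Fin d) ℂ) :
    Commute M (X ⊗ₖ Y + Y ⊗ₖ X) := by
  have h := ((commute_kroneckerSum hd hM X).mul_right (commute_kroneckerSum hd hM Y)).sub_right
    (commute_kroneckerSum hd hM (X * Y))
  have e : X ⊗ₖ Y + Y ⊗ₖ X = (X ⊗ₖ (1 : Matrix (Fin d) (Fin d) ℂ) +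
      (1 : Matrix (Fin d) (Fin d) ℂ) ⊗ₖ X) * (Y ⊗ₖ (1 : Matrix (Fin d) (Fin d) ℂ) +
      (1 : Matrix (Fin d) (Fin d) ℂ) ⊗ₖ Y) - ((X * Y) ⊗ₖ (1 : Matrix (Fin d) (Fin d) ℂ) +
      (1 : Matrix (Fin d) (Fin d) ℂ) ⊗ₖ (X * Y)) := by
    simp only [add_mul, mul_add, ← mul_kronecker_mul, one_mul, mul_one]
    abel
  rw [e]
  exact h

/-- An operator commuting with all `U ⊗ U` is a combination of the identity and the swap. -/
lemma eq_add_swapOp_of_commute (hd : 2 ≤ d) {M : Matrix (Fin d × Fin d) (Fin d × Fin d) ℂ}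
    (hM : ∀ U : SU d, Commute M (U.1 ⊗ₖ U.1)) :
    ∃ a b : ℂ, M = a • (1 : Matrix (Fin d × Fin d) (Fin d × Fin d) ℂ) + b • swapOp d := by
  let r : Fin d := ⟨0, by omega⟩
  let s : Fin d := ⟨1, by omega⟩
  have hrs : r ≠ s := by simp [r, s]
  refine ⟨M (r, s) (r, s), M (s, r) (r, s), ?_⟩
  ext ⟨a, b⟩ ⟨p, q⟩
  -- With `X = |p⟩⟨r|` and `Y = |q⟩⟨s|`, the operator `X ⊗ Y + Y ⊗ X` maps `|r s⟩` to `|p q⟩`, the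
  -- second term vanishing since `r ≠ s`. Hence the column `(r, s)` of `M` determines all its
  -- columns, and only its entries at `(r, s)` and `(s, r)` contribute.
  have h := entry_eq (commute_kronecker_symm (by omega) hM (single p r 1)
    (single q s 1)).eq (a, b) (r, s)
  simp only [mul_apply, Matrix.add_apply, kroneckerMap_apply, single_apply, Fintype.sum_prod_type,
    mul_add, add_mul, Finset.sum_add_distrib] at h
  simp only [hrs, hrs.symm, and_true, and_false, if_false, mul_zero, zero_mul, Finset.sum_const_zero,
    add_zero, mul_ite, mul_one, Finset.sum_ite_eq, ite_mul, one_mul, zero_mul,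
    Finset.mem_univ, if_true, ite_and] at h
  simp only [Finset.sum_ite_irrel, Finset.sum_ite_eq, Finset.sum_const_zero, Finset.mem_univ,
    if_true] at h
  rw [h]
  simp only [swapOp, Matrix.add_apply, Matrix.smul_apply, of_apply, one_apply, Prod.mk.injEq, smul_eq_mul,
    ite_and]
  simp only [eq_comm, mul_ite, mul_one, mul_zero]
  split_ifs <;> simp_all

lemma swapOp_apply (x y : Fin d × Fin d) :
    swapOp d x y = if x.1 = y.2 ∧ x.2 = y.1 then 1 else 0 := rfl

lemma symmetryOp_eq_submatrix (U W : SU d) :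
    symmetryOp U W = ((U.1 ⊗ₖ U.1) ⊗ₖ (W.1 ⊗ₖ W.1)).submatrix (group3120 d) (group3120 d) := by
  ext w v
  simp only [symmetryOp, kroneckerMap_apply, submatrix_apply, group3120, Equiv.coe_fn_mk]
  ring

/-- The general combination of the permutations of the wires `3, 1` and `2, 0`. -/
def permComb (d : ℕ) (x y z t : ℂ) : Matrix (Wires d) (Wires d) ℂ :=
  x • tensor3120 1 1 + y • tensor3120 (swapOp d) 1 + z • tensor3120 1 (swapOp d) +
    t • tensor3120 (swapOp d) (swapOp d)

/-- The commutant lemma is used twice. With `W = 1` it describes each block of `C` with fixed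
indices on `20`; with `U = 1` it applies to the two matrices formed by the coefficients of these
blocks. -/
lemma IsCovariant.exists_eq_permComb (hd : 2 ≤ d) {C : Matrix (Wires d) (Wires d) ℂ}
    (hC : IsCovariant C) : ∃ x y z t : ℂ, C = permComb d x y z t := by
  set C' := C.submatrix (group3120 d).symm (group3120 d).symm with hC'
  have hcom : ∀ U W : SU d, Commute C' ((U.1 ⊗ₖ U.1) ⊗ₖ (W.1 ⊗ₖ W.1)) := by
    intro U W
    have h := congrArg (fun M => M.submatrix (group3120 d).symm (group3120 d).symm) (hC U W).eq
    simp only [symmetryOp_eq_submatrix] at h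
    rw [← submatrix_mul_equiv _ _ _ (group3120 d).symm, ← submatrix_mul_equiv _ _ _ (group3120 d).symm]
      at h
    simpa [Commute, SemiconjBy, hC'] using h
  have hblock : ∀ p q : Fin d × Fin d, ∃ a b : ℂ,
      (of fun i j => C' (i, p) (j, q)) =
        a • (1 : Matrix (Fin d × Fin d) (Fin d × Fin d) ℂ) + b • swapOp d := by
    intro p q
    refine eq_add_swapOp_of_commute hd fun U => ?_
    have h := (hcom U 1).eq
    ext i j
    have h2 := entry_eq h (i, p) (j, q)
    rw [OneMemClass.coe_one, one_kronecker_one, mul_kronecker_one_apply,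
      kronecker_one_mul_apply] at h2
    rw [mul_apply, mul_apply]
    exact h2
  choose a b hab using hblock
  have hval : ∀ i j p q, C' (i, p) (j, q) =
      a p q * (1 : Matrix (Fin d × Fin d) (Fin d × Fin d) ℂ) i j + b p q * swapOp d i j := by
    intro i j p q
    exact entry_eq (hab p q) i j
  let r : Fin d := ⟨0, by omega⟩
  let s : Fin d := ⟨1, by omega⟩
  have hrs : r ≠ s := by simp [r, s]
  have hright : ∀ (W : SU d) (i j p q : Fin d × Fin d),
      ∑ u, C' (i, p) (j, u) * (W.1 ⊗ₖ W.1) u q = ∑ u, (W.1 ⊗ₖ W.1) p u * C' (i, u) (j, q) := by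
    intro W i j p q
    have h2 := entry_eq (hcom 1 W).eq (i, p) (j, q)
    rwa [OneMemClass.coe_one, one_kronecker_one, mul_one_kronecker_apply,
      one_kronecker_mul_apply] at h2
  -- The entries `((r, s), (r, s))` and `((r, s), (s, r))` on `31` separate the two coefficients:
  -- the identity is `1, 0` there and the swap is `0, 1`.
  obtain ⟨x, z, ha⟩ := eq_add_swapOp_of_commute hd (M := of a) fun W => by
    ext p q
    simpa [mul_apply, hval, one_apply, swapOp, hrs] using hright W (r, s) (r, s) p q
  obtain ⟨y, t, hb⟩ := eq_add_swapOp_of_commute hd (M := of b) fun W => by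
    ext p q
    simpa [mul_apply, hval, one_apply, swapOp, hrs, hrs.symm] using hright W (r, s) (s, r) p q
  refine ⟨x, y, z, t, ?_⟩
  ext w v
  have h1 : C w v = C' (group3120 d w) (group3120 d v) := by simp [hC']
  have h2 : ∀ p q, a p q = x * (1 : Matrix (Fin d × Fin d) (Fin d × Fin d) ℂ) p q +
      z * swapOp d p q := fun p q => entry_eq ha p q
  have h3 : ∀ p q, b p q = y * (1 : Matrix (Fin d × Fin d) (Fin d × Fin d) ℂ) p q +
      t * swapOp d p q := fun p q => entry_eq hb p q
  rw [h1, ← Prod.mk.eta (p := group3120 d w), ← Prod.mk.eta (p := group3120 d v), hval, h2, h3]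
  simp only [permComb, tensor3120, Matrix.add_apply, Matrix.smul_apply, submatrix_apply, kroneckerMap_apply,
    smul_eq_mul]
  ring

end Commutant

/-! ### Haar averages of matrix-valued functions -/

section HaarAverage

variable {d : ℕ}

instance isHaarMeasure_haarSU (d : ℕ) : (haarSU d).IsHaarMeasure :=
  inferInstanceAs (Measure.haarMeasure ⊤).IsHaarMeasure

instance isProbabilityMeasure_haarSU (d : ℕ) : IsProbabilityMeasure (haarSU d) :=
  ⟨by simpa [haarSU] using
    Measure.haarMeasure_self (K₀ := (⊤ : TopologicalSpace.PositiveCompacts (SU d)))⟩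

/-- A right translate of the Haar measure is again a Haar probability measure, so uniqueness
identifies the two. -/
instance isMulRightInvariant_haarSU (d : ℕ) : (haarSU d).IsMulRightInvariant := by
  refine ⟨fun g => ?_⟩
  have : IsProbabilityMeasure (Measure.map (· * g) (haarSU d)) :=
    Measure.isProbabilityMeasure_map (by fun_prop)
  exact Measure.isHaarMeasure_eq_of_isProbabilityMeasure _ _

lemma integrable_of_continuous_SU {f : SU d → ℂ} (hf : Continuous f) :
    Integrable f (haarSU d) :=
  hf.integrable_of_hasCompactSupport (HasCompactSupport.of_compactSpace f)

variable {m n p q : Type*}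

lemma haarAvg_apply (f : SU d → Matrix m n ℂ) (i : m) (j : n) :
    haarAvg f i j = ∫ U, f U i j ∂(haarSU d) := rfl

lemma haarAvg_const (A : Matrix m n ℂ) : haarAvg (fun _ : SU d => A) = A := by
  ext i j
  simp [haarAvg_apply]

lemma haarAvg_mul_left (f : SU d → Matrix m n ℂ) (V : SU d) :
    haarAvg (fun U => f (V * U)) = haarAvg f := by
  ext i j
  exact integral_mul_left_eq_self (fun U => f U i j) V

lemma haarAvg_mul_right (f : SU d → Matrix m n ℂ) (V : SU d) :
    haarAvg (fun U => f (U * V)) = haarAvg f := by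
  ext i j
  exact integral_mul_right_eq_self (fun U => f U i j) V

lemma linearMap_apply_eq_sum [Fintype m] [Fintype n] [DecidableEq m] [DecidableEq n]
    (L : Matrix m n ℂ →ₗ[ℂ] ℂ) (A : Matrix m n ℂ) :
    L A = ∑ i, ∑ j, A i j * L (single i j 1) := by
  conv_lhs => rw [matrix_eq_sum_single A]
  simp only [map_sum]
  refine Finset.sum_congr rfl fun i _ => Finset.sum_congr rfl fun j _ => ?_
  rw [← smul_eq_mul, ← map_smul, smul_single, smul_eq_mul, mul_one]

/-- A linear functional is a finite combination of entries, so the entrywise integral commutes with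
it. All later exchanges of averages with traces, products and quadratic forms rest on this lemma. -/
lemma functional_haarAvg [Finite m] [Finite n] (L : Matrix m n ℂ →ₗ[ℂ] ℂ)
    {f : SU d → Matrix m n ℂ} (hf : Continuous f) :
    L (haarAvg f) = ∫ U, L (f U) ∂(haarSU d) := by
  classical
  have := Fintype.ofFinite m
  have := Fintype.ofFinite n
  have hint : ∀ i j, Integrable (fun U => f U i j * L (single i j 1)) (haarSU d) := fun i j =>
    (integrable_of_continuous_SU (hf.matrix_elem i j)).mul_const _
  rw [linearMap_apply_eq_sum L]
  simp only [fun U => linearMap_apply_eq_sum L (f U), haarAvg_apply]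
  rw [integral_finsetSum _ fun i _ => integrable_finsetSum _ fun j _ => hint i j]
  refine Finset.sum_congr rfl fun i _ => ?_
  rw [integral_finsetSum _ fun j _ => hint i j]
  simp only [integral_mul_const]

lemma map_haarAvg [Finite m] [Finite n] (L : Matrix m n ℂ →ₗ[ℂ] Matrix p q ℂ)
    {f : SU d → Matrix m n ℂ} (hf : Continuous f) :
    L (haarAvg f) = haarAvg fun U => L (f U) := by
  ext i j
  exact functional_haarAvg ((entryLinearMap ℂ ℂ i j).comp L) hf

/-- The linear map `X ↦ A X B`. -/
def mulMulLin [Fintype m] [Fintype n] (A : Matrix p m ℂ) (B : Matrix n q ℂ) :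
    Matrix m n ℂ →ₗ[ℂ] Matrix p q ℂ where
  toFun X := A * X * B
  map_add' X Y := by rw [Matrix.mul_add, Matrix.add_mul]
  map_smul' c X := by simp

lemma mul_haarAvg_mul [Fintype m] [Fintype n] (A : Matrix p m ℂ) (B : Matrix n q ℂ)
    {f : SU d → Matrix m n ℂ} (hf : Continuous f) :
    A * haarAvg f * B = haarAvg fun U => A * f U * B :=
  map_haarAvg (mulMulLin A B) hf

lemma conjTranspose_haarAvg (f : SU d → Matrix m n ℂ) :
    (haarAvg f)ᴴ = haarAvg fun U => (f U)ᴴ := by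
  ext i j
  simp only [conjTranspose_apply, haarAvg_apply]
  exact integral_conj.symm

lemma conjM_haarAvg (f : SU d → Matrix m n ℂ) :
    conjM (haarAvg f) = haarAvg fun U => conjM (f U) := by
  ext i j
  simp only [conjM, map_apply, haarAvg_apply]
  exact integral_conj.symm

lemma posSemidef_haarAvg [Fintype m] {f : SU d → Matrix m m ℂ} (hf : Continuous f)
    (hpos : ∀ U, (f U).PosSemidef) : (haarAvg f).PosSemidef := by
  refine PosSemidef.of_dotProduct_mulVec_nonneg ?_ fun x => ?_
  · rw [IsHermitian, conjTranspose_haarAvg]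
    simp only [(hpos _).isHermitian.eq]
  · let L : Matrix m m ℂ →ₗ[ℂ] ℂ :=
      { toFun := fun X => star x ⬝ᵥ (X *ᵥ x)
        map_add' := fun X Y => by rw [add_mulVec, dotProduct_add]
        map_smul' := fun c X => by rw [smul_mulVec, dotProduct_smul, RingHom.id_apply] }
    have h := functional_haarAvg L hf
    change 0 ≤ L (haarAvg f)
    rw [h]
    exact integral_nonneg fun U => (hpos U).dotProduct_mulVec_nonneg x

end HaarAverage

/-! ### Continuity -/

section Continuity

variable {d : ℕ}

lemma continuous_coe_SU : Continuous fun U : SU d => U.1 := continuous_subtype_val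

lemma continuous_kronecker {X m n p q : Type*} [TopologicalSpace X]
    {f : X → Matrix m n ℂ} {g : X → Matrix p q ℂ} (hf : Continuous f) (hg : Continuous g) :
    Continuous fun x => f x ⊗ₖ g x :=
  continuous_matrix fun i j => (hf.matrix_elem i.1 j.1).mul (hg.matrix_elem i.2 j.2)

lemma continuous_dproj {X m n : Type*} [TopologicalSpace X]
    {f : X → Matrix m n ℂ} (hf : Continuous f) : Continuous fun x => dproj (f x) :=
  continuous_matrix fun i j => (hf.matrix_elem i.1 i.2).mul (hf.matrix_elem j.1 j.2).star

lemma continuous_conjM {X m n : Type*} [TopologicalSpace X]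
    {f : X → Matrix m n ℂ} (hf : Continuous f) : Continuous fun x => conjM (f x) :=
  continuous_matrix fun i j => (hf.matrix_elem i j).star

lemma continuous_tensor3021 {X : Type*} [TopologicalSpace X]
    {f g : X → Matrix (Fin d × Fin d) (Fin d × Fin d) ℂ} (hf : Continuous f) (hg : Continuous g) :
    Continuous fun x => tensor3021 (f x) (g x) :=
  (continuous_kronecker hf hg).matrix_submatrix _ _

lemma continuous_symmetryOp {X : Type*} [TopologicalSpace X] {f g : X → SU d}
    (hf : Continuous f) (hg : Continuous g) : Continuous fun x => symmetryOp (f x) (g x) :=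
  continuous_kronecker (continuous_coe_SU.comp hf) (continuous_kronecker (continuous_coe_SU.comp hg)
    (continuous_kronecker (continuous_coe_SU.comp hf) (continuous_coe_SU.comp hg)))

lemma continuous_symmetryOp_conj {X : Type*} [TopologicalSpace X] {f g : X → SU d}
    (hf : Continuous f) (hg : Continuous g) (C : Matrix (Wires d) (Wires d) ℂ) :
    Continuous fun x => symmetryOp (f x) (g x) * C * (symmetryOp (f x) (g x))ᴴ :=
  ((continuous_symmetryOp hf hg).matrix_mul continuous_const).matrix_mul
    (continuous_symmetryOp hf hg).matrix_conjTranspose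

lemma continuous_conj_symmetryOp_left (W : SU d) (C : Matrix (Wires d) (Wires d) ℂ) :
    Continuous fun U : SU d => symmetryOp U W * C * (symmetryOp U W)ᴴ :=
  continuous_symmetryOp_conj continuous_id continuous_const C

lemma continuous_conj_symmetryOp_right (U : SU d) (C : Matrix (Wires d) (Wires d) ℂ) :
    Continuous fun W : SU d => symmetryOp U W * C * (symmetryOp U W)ᴴ :=
  continuous_symmetryOp_conj continuous_const continuous_id C

end Continuity

/-! ### The symmetry group -/

section Symmetry

variable {d : ℕ}

lemma SU_conjTranspose_mul (U : SU d) : U.1ᴴ * U.1 = 1 :=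
  mem_unitaryGroup_iff'.mp (mem_specialUnitaryGroup_iff.mp U.2).1

lemma SU_mul_conjTranspose (U : SU d) : U.1 * U.1ᴴ = 1 :=
  mem_unitaryGroup_iff.mp (mem_specialUnitaryGroup_iff.mp U.2).1

lemma symmetryOp_mul (U V W X : SU d) :
    symmetryOp U W * symmetryOp V X = symmetryOp (U * V) (W * X) := by
  simp only [symmetryOp, ← mul_kronecker_mul, Submonoid.coe_mul]

lemma symmetryOp_conjTranspose_mul (U W : SU d) : (symmetryOp U W)ᴴ * symmetryOp U W = 1 := by
  simp only [symmetryOp, conjTranspose_kronecker, ← mul_kronecker_mul, SU_conjTranspose_mul,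
    one_kronecker_one]

lemma commute_of_conj_eq {n : Type*} [Fintype n] [DecidableEq n] {S C : Matrix n n ℂ}
    (hS : Sᴴ * S = 1) (h : S * C * Sᴴ = C) : Commute C S := by
  change C * S = S * C
  conv_lhs => rw [← h]
  rw [Matrix.mul_assoc, hS, Matrix.mul_one]

lemma conj_symmetryOp_mul (U V W X : SU d) (C : Matrix (Wires d) (Wires d) ℂ) :
    symmetryOp U W * (symmetryOp V X * C * (symmetryOp V X)ᴴ) * (symmetryOp U W)ᴴ =
      symmetryOp (U * V) (W * X) * C * (symmetryOp (U * V) (W * X))ᴴ := by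
  rw [← symmetryOp_mul, conjTranspose_mul]
  simp only [Matrix.mul_assoc]

/-- The double average splits into two single ones because `symmetryOp U W` factors into commuting
parts. Each can then be handled by the invariance and linearity of one Haar integral, without
Fubini. -/
lemma twirl_eq (C : Matrix (Wires d) (Wires d) ℂ) :
    twirl C = haarAvg fun U : SU d => symmetryOp U 1 *
      (haarAvg fun W : SU d => symmetryOp 1 W * C * (symmetryOp 1 W)ᴴ) * (symmetryOp U 1)ᴴ := by
  refine congrArg haarAvg (funext fun U => ?_)
  rw [mul_haarAvg_mul _ _ (continuous_conj_symmetryOp_right 1 C)]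
  refine congrArg haarAvg (funext fun W => ?_)
  rw [conj_symmetryOp_mul, mul_one, one_mul]

lemma isCovariant_twirl (C : Matrix (Wires d) (Wires d) ℂ) : IsCovariant (twirl C) := by
  intro A B
  refine commute_of_conj_eq (symmetryOp_conjTranspose_mul A B) ?_
  rw [twirl_eq]
  set D := haarAvg fun W : SU d => symmetryOp 1 W * C * (symmetryOp 1 W)ᴴ with hD
  -- The inner average absorbs the action of `B`; the outer one absorbs that of `A` below.
  have hDB : symmetryOp 1 B * D * (symmetryOp 1 B)ᴴ = D := by
    rw [hD, mul_haarAvg_mul _ _ (continuous_conj_symmetryOp_right 1 C),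
      ← haarAvg_mul_left (fun W : SU d => symmetryOp 1 W * C * (symmetryOp 1 W)ᴴ) B]
    refine congrArg haarAvg (funext fun W => ?_)
    rw [conj_symmetryOp_mul, one_mul]
  rw [mul_haarAvg_mul _ _ (continuous_conj_symmetryOp_left 1 D),
      ← haarAvg_mul_left (fun U : SU d => symmetryOp U 1 * D * (symmetryOp U 1)ᴴ) A]
  refine congrArg haarAvg (funext fun U => ?_)
  rw [conj_symmetryOp_mul]
  conv_rhs => rw [← hDB, conj_symmetryOp_mul]
  simp only [mul_one, one_mul]

/-- The functional `X ↦ Tr[X Ω]`. -/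
def traceMulLin {n : Type*} [Fintype n] (Ω : Matrix n n ℂ) : Matrix n n ℂ →ₗ[ℂ] ℂ where
  toFun X := (X * Ω).trace
  map_add' X Y := by rw [Matrix.add_mul, trace_add]
  map_smul' c X := by simp

lemma trace_conj_mul_of_commute {n : Type*} [Fintype n] [DecidableEq n] {S Ω : Matrix n n ℂ}
    (hS : Sᴴ * S = 1) (h : Commute Ω S) (C : Matrix n n ℂ) :
    (S * C * Sᴴ * Ω).trace = (C * Ω).trace := by
  have h2 : Sᴴ * Ω * S = Ω := by
    rw [Matrix.mul_assoc, h.eq, ← Matrix.mul_assoc, hS, Matrix.one_mul]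
  rw [Matrix.mul_assoc, Matrix.mul_assoc, trace_mul_comm, Matrix.mul_assoc, Matrix.mul_assoc,
    ← Matrix.mul_assoc Sᴴ, h2]

lemma trace_twirl_mul {Ω : Matrix (Wires d) (Wires d) ℂ} (hΩ : IsCovariant Ω)
    (C : Matrix (Wires d) (Wires d) ℂ) : (twirl C * Ω).trace = (C * Ω).trace := by
  -- Arbitrary continuous `f` and `g` let one statement cover both averages of `twirl_eq`, with the
  -- other argument set to `1`.
  have key : ∀ (f g : SU d → SU d), Continuous f → Continuous g →
      ∀ D : Matrix (Wires d) (Wires d) ℂ,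
      ((haarAvg fun U : SU d => symmetryOp (f U) (g U) * D * (symmetryOp (f U) (g U))ᴴ) * Ω).trace =
        (D * Ω).trace := by
    intro f g hf hg D
    refine (functional_haarAvg (traceMulLin Ω) (continuous_symmetryOp_conj hf hg D)).trans ?_
    simp only [traceMulLin, LinearMap.coe_mk, AddHom.coe_mk,
      trace_conj_mul_of_commute (symmetryOp_conjTranspose_mul _ _) (hΩ _ _)]
    simp
  rw [twirl_eq, key (fun U => U) (fun _ => 1) continuous_id continuous_const,
    key (fun _ => 1) (fun U => U) continuous_const continuous_id]

end Symmetry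

/-! ### Averages of combs -/

section Combs

variable {d : ℕ} {m n : Type*}

lemma traceLeft_apply [Fintype m] (M : Matrix (m × n) (m × n) ℂ) (x y : n) :
    traceLeft M x y = ∑ i, M (i, x) (i, y) := rfl

lemma traceRight_apply [Fintype n] (M : Matrix (m × n) (m × n) ℂ) (x y : m) :
    traceRight M x y = ∑ i, M (x, i) (y, i) := rfl

/-- The partial trace over the first factor as a linear map. -/
def traceLeftLin (m n : Type*) [Fintype m] : Matrix (m × n) (m × n) ℂ →ₗ[ℂ] Matrix n n ℂ where
  toFun := traceLeft
  map_add' X Y := by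
    ext x y
    simp [traceLeft_apply, Finset.sum_add_distrib]
  map_smul' c X := by
    ext x y
    simp [traceLeft_apply, Finset.mul_sum]

/-- The partial trace over the second factor as a linear map. -/
def traceRightLin (m n : Type*) [Fintype n] : Matrix (m × n) (m × n) ℂ →ₗ[ℂ] Matrix m m ℂ where
  toFun := traceRight
  map_add' X Y := by
    ext x y
    simp [traceRight_apply, Finset.sum_add_distrib]
  map_smul' c X := by
    ext x y
    simp [traceRight_apply, Finset.mul_sum]

lemma traceLeft_one_kronecker [Fintype m] [DecidableEq m] (A : Matrix n n ℂ) :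
    traceLeft ((1 : Matrix m m ℂ) ⊗ₖ A) = (Fintype.card m : ℂ) • A := by
  ext x y
  simp [traceLeft_apply]

/-- The isometry acting on the traced factor cancels by cyclicity of the trace over that factor. -/
lemma traceLeft_conj_kronecker [Fintype m] [DecidableEq m] [Fintype n]
    {A : Matrix m m ℂ} (hA : Aᴴ * A = 1) (B : Matrix n n ℂ) (C : Matrix (m × n) (m × n) ℂ) :
    traceLeft ((A ⊗ₖ B) * C * (A ⊗ₖ B)ᴴ) = B * traceLeft C * Bᴴ := by
  ext x y
  have h : ∀ k l : m, ∑ i, A i k * star (A i l) = (1 : Matrix m m ℂ) k l := by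
    intro k l
    have h1 := entry_eq hA l k
    simp only [mul_apply, conjTranspose_apply] at h1
    rw [one_apply] at h1 ⊢
    simp only [eq_comm (a := k), ← h1, mul_comm]
  calc traceLeft ((A ⊗ₖ B) * C * (A ⊗ₖ B)ᴴ) x y
      = ∑ i, ∑ l, ∑ s, ∑ k, ∑ r, A i k * B x r * C (k, r) (l, s) * (star (A i l) * star (B y s)) := by
        simp only [traceLeft_apply, mul_apply, Fintype.sum_prod_type, conjTranspose_apply,
          kroneckerMap_apply, star_mul', Finset.sum_mul]
    _ = ∑ l, ∑ s, ∑ k, ∑ r, (∑ i, A i k * star (A i l)) * (B x r * C (k, r) (l, s) * star (B y s)) := by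
        simp only [Finset.sum_mul]
        rw [Finset.sum_comm]
        refine Finset.sum_congr rfl fun l _ => ?_
        rw [Finset.sum_comm]
        refine Finset.sum_congr rfl fun s _ => ?_
        rw [Finset.sum_comm]
        refine Finset.sum_congr rfl fun k _ => ?_
        rw [Finset.sum_comm]
        refine Finset.sum_congr rfl fun r _ => Finset.sum_congr rfl fun i _ => ?_
        ring
    _ = ∑ l, ∑ s, ∑ r, B x r * C (l, r) (l, s) * star (B y s) := by
        simp only [h, one_apply, ite_mul, one_mul, zero_mul]
        refine Finset.sum_congr rfl fun l _ => Finset.sum_congr rfl fun s _ => ?_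
        rw [Finset.sum_comm]
        simp
    _ = (B * traceLeft C * Bᴴ) x y := by
        simp only [traceLeft_apply, mul_apply, conjTranspose_apply, Finset.sum_mul, Finset.mul_sum]
        rw [Finset.sum_comm]
        refine Finset.sum_congr rfl fun s _ => ?_
        rw [Finset.sum_comm]

/-- The operator `C⁽¹⁾` is determined by `C`. Replacing the existential by `reducedComb` makes the
normalization conditions affine in `C`, so they survive averaging. -/
lemma isOneSlotComb_iff (hd : d ≠ 0) {C : Matrix (Wires d) (Wires d) ℂ} :
    IsOneSlotComb C ↔ C.PosSemidef ∧
      traceLeft C = (1 : Matrix (Fin d) (Fin d) ℂ) ⊗ₖ reducedComb C ∧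
      traceLeft (reducedComb C) = 1 := by
  refine ⟨fun ⟨hp, C₁, h1, h2⟩ => ?_, fun ⟨hp, h1, h2⟩ => ⟨hp, _, h1, h2⟩⟩
  have h : reducedComb C = C₁ := by
    rw [reducedComb, h1, traceLeft_one_kronecker, Fintype.card_fin, smul_smul,
      inv_mul_cancel₀ (Nat.cast_ne_zero.mpr hd), one_smul]
  rw [h]
  exact ⟨hp, h1, h2⟩

/-- The tensor product with the identity on the left as a linear map. -/
def oneKroneckerLin (m n : Type*) [DecidableEq m] :
    Matrix n n ℂ →ₗ[ℂ] Matrix (m × n) (m × n) ℂ where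
  toFun A := (1 : Matrix m m ℂ) ⊗ₖ A
  map_add' _ _ := kronecker_add _ _ _
  map_smul' _ _ := kronecker_smul _ _ _

lemma continuous_linearMap_comp {X p q : Type*} [TopologicalSpace X] [Finite m] [Finite n]
    (L : Matrix m n ℂ →ₗ[ℂ] Matrix p q ℂ) {f : X → Matrix m n ℂ} (hf : Continuous f) :
    Continuous fun x => L (f x) :=
  (LinearMap.continuous_of_finiteDimensional L).comp hf

lemma isOneSlotComb_haarAvg (hd : d ≠ 0) {f : SU d → Matrix (Wires d) (Wires d) ℂ}
    (hf : Continuous f) (h : ∀ U, IsOneSlotComb (f U)) : IsOneSlotComb (haarAvg f) := by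
  simp only [isOneSlotComb_iff hd] at h ⊢
  let R : Matrix (Wires d) (Wires d) ℂ →ₗ[ℂ] Matrix (Fin d × Fin d) (Fin d × Fin d) ℂ :=
    (d : ℂ)⁻¹ • (traceLeftLin (Fin d) (Fin d × Fin d)).comp
      (traceLeftLin (Fin d) (Fin d × Fin d × Fin d))
  have hR : reducedComb (haarAvg f) = haarAvg fun U => reducedComb (f U) := map_haarAvg R hf
  have hRc : Continuous fun U => reducedComb (f U) := continuous_linearMap_comp R hf
  refine ⟨posSemidef_haarAvg hf fun U => (h U).1, ?_, ?_⟩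
  · rw [hR]
    refine (map_haarAvg (traceLeftLin (Fin d) _) hf).trans
      (Eq.trans ?_ (map_haarAvg (oneKroneckerLin (Fin d) _) hRc).symm)
    exact congrArg haarAvg (funext fun U => (h U).2.1)
  · rw [hR]
    refine (map_haarAvg (traceLeftLin (Fin d) _) hRc).trans (Eq.trans ?_ (haarAvg_const (d := d) 1))
    exact congrArg haarAvg (funext fun U => (h U).2.2)

lemma IsOneSlotComb.conj_symmetryOp {C : Matrix (Wires d) (Wires d) ℂ} (hC : IsOneSlotComb C)
    (U W : SU d) : IsOneSlotComb (symmetryOp U W * C * (symmetryOp U W)ᴴ) := by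
  obtain ⟨hp, C₁, h1, h2⟩ := hC
  refine ⟨hp.mul_mul_conjTranspose_same _, (U.1 ⊗ₖ W.1) * C₁ * (U.1 ⊗ₖ W.1)ᴴ, ?_, ?_⟩
  · rw [symmetryOp, traceLeft_conj_kronecker (SU_conjTranspose_mul U), h1,
      conjTranspose_kronecker W.1, ← mul_kronecker_mul, ← mul_kronecker_mul, Matrix.mul_one,
      SU_mul_conjTranspose]
  · rw [traceLeft_conj_kronecker (SU_conjTranspose_mul U), h2, Matrix.mul_one,
      SU_mul_conjTranspose]

lemma IsOneSlotComb.twirl (hd : d ≠ 0) {C : Matrix (Wires d) (Wires d) ℂ}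
    (hC : IsOneSlotComb C) : IsOneSlotComb (twirl C) := by
  rw [twirl_eq]
  refine isOneSlotComb_haarAvg hd (continuous_conj_symmetryOp_left 1 _)
    fun U => IsOneSlotComb.conj_symmetryOp ?_ U 1
  exact isOneSlotComb_haarAvg hd (continuous_conj_symmetryOp_right 1 C)
    fun W => hC.conj_symmetryOp 1 W

end Combs

/-! ### Fidelity with a pure state -/

section Fidelity

/-- A rank-one projector `P` is its own square root and `P ρ P = ⟨ψ|ρ|ψ⟩ P`, whose square root has
trace `√⟨ψ|ρ|ψ⟩`. -/
lemma stateFidelity_pure {m : Type*} [Fintype m] [DecidableEq m] {ρ : Matrix m m ℂ}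
    (hρ : ρ.PosSemidef) {ψ : m → ℂ} (hψ : star ψ ⬝ᵥ ψ = 1) :
    stateFidelity ρ (vecMulVec ψ (star ψ)) = (star ψ ⬝ᵥ (ρ *ᵥ ψ)).re := by
  set P := vecMulVec ψ (star ψ) with hP
  have hP0 : P.PosSemidef := posSemidef_vecMulVec_self_star ψ
  have hPP : P * P = P := by
    rw [hP, vecMulVec_mul_vecMulVec, hψ, one_smul]
  have hsP : CFC.sqrt P = P := CFC.sqrt_unique hPP hP0.nonneg
  set c := star ψ ⬝ᵥ (ρ *ᵥ ψ) with hc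
  have hc0 : 0 ≤ c := hρ.dotProduct_mulVec_nonneg ψ
  have hcre : 0 ≤ c.re := (Complex.nonneg_iff.mp hc0).1
  have hcc : ((c.re : ℝ) : ℂ) = c := Complex.ext rfl (by
    simpa using (Complex.nonneg_iff.mp hc0).2)
  have hPρP : P * ρ * P = c • P := by
    rw [hP, vecMulVec_mul, vecMulVec_mul_vecMulVec, ← dotProduct_mulVec, vecMulVec_smul]
  have hs : ((Real.sqrt c.re : ℝ) : ℂ) * ((Real.sqrt c.re : ℝ) : ℂ) = c := by
    rw [← Complex.ofReal_mul, Real.mul_self_sqrt hcre, hcc]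
  have hsq : CFC.sqrt (c • P) = ((Real.sqrt c.re : ℝ) : ℂ) • P := by
    refine CFC.sqrt_unique ?_ ?_
    · rw [smul_mul_smul_comm, hPP, hs]
    · exact (hP0.smul (Complex.zero_le_real.mpr (Real.sqrt_nonneg _))).nonneg
  have htr : P.trace = 1 := by rw [hP, trace_vecMulVec, dotProduct_comm, hψ]
  rw [stateFidelity, hsP, hPρP, hsq, trace_smul, htr, smul_eq_mul, mul_one, Complex.norm_real,
    Real.norm_eq_abs, sq_abs, Real.sq_sqrt hcre]

variable {d : ℕ}

lemma plug_apply (C : Matrix (Wires d) (Wires d) ℂ)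
    (E : Matrix (Fin d × Fin d) (Fin d × Fin d) ℂ) (a b : Fin d × Fin d) :
    plug C E a b = ∑ y, ∑ k, C (a.1, k.1, k.2, a.2) (b.1, y.1, y.2, b.2) * E k y := by
  simp only [plug, link, traceRight_apply]
  refine Finset.sum_congr rfl fun y _ => ?_
  rw [← Prod.mk.eta (p := a), ← Prod.mk.eta (p := b), mul_one_kronecker_apply]
  rfl

lemma posSemidef_plug_dproj {C : Matrix (Wires d) (Wires d) ℂ} (hC : C.PosSemidef)
    (A : Matrix (Fin d) (Fin d) ℂ) : (plug C (dproj A)).PosSemidef := by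
  -- Because of the partial transposition in the link product, `B` is `I_{30}` tensored with the
  -- transpose of `|A⟩⟩`, without conjugation.
  let B : Matrix (Fin d × Fin d) ((Fin d × Fin d) × (Fin d × Fin d)) ℂ :=
    of fun a u => (1 : Matrix (Fin d × Fin d) (Fin d × Fin d) ℂ) a u.1 * dket A u.2
  have h : plug C (dproj A) =
      B * C.submatrix (group3021 d).symm (group3021 d).symm * Bᴴ := by
    ext a b
    rw [plug_apply, mul_apply]
    simp only [mul_apply, B, of_apply, conjTranspose_apply, submatrix_apply, star_mul',
      Finset.sum_mul]
    conv_rhs => rw [Fintype.sum_prod_type_right]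
    refine Finset.sum_congr rfl fun y _ => ?_
    symm
    refine (Finset.sum_eq_single b (fun u _ hu => by simp [one_apply_ne hu.symm])
      (by simp)).trans ?_
    rw [Fintype.sum_prod_type_right]
    refine Finset.sum_congr rfl fun k _ => ?_
    refine (Finset.sum_eq_single a (fun u _ hu => by simp [one_apply_ne hu.symm])
      (by simp)).trans ?_
    simp only [one_apply_eq, one_mul, star_one, dproj, vecMulVec_apply, Pi.star_apply]
    simp only [group3021, Equiv.coe_fn_symm_mk]
    ring
  rw [h]
  exact (hC.submatrix _).mul_mul_conjTranspose_same B

/-- The vector `|U†⟩⟩_{30} ⊗ |U^*⟩⟩_{21}`. -/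
def combKet (U : SU d) : Wires d → ℂ := fun w => dket U.1ᴴ (w.1, w.2.2.2) *
  dket (conjM U.1) (w.2.1, w.2.2.1)

/-- The operator `|U†⟩⟩⟨⟨U†|_{30} ⊗ |U^*⟩⟩⟨⟨U^*|_{21}`. -/
def combProj (U : SU d) : Matrix (Wires d) (Wires d) ℂ :=
  tensor3021 (dproj U.1.conjTranspose) (dproj (conjM U.1))

lemma combKet_apply (U : SU d) (w : Wires d) :
    combKet U w = star (U.1 w.2.2.2 w.1) * star (U.1 w.2.1 w.2.2.1) := rfl

lemma combProj_eq_vecMulVec (U : SU d) : combProj U = vecMulVec (combKet U) (star (combKet U)) := by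
  ext w v
  simp only [combProj, tensor3021, submatrix_apply, kroneckerMap_apply, dproj, vecMulVec_apply,
    Pi.star_apply, combKet, group3021, Equiv.coe_fn_mk, star_mul']
  ring

lemma continuous_combProj : Continuous (combProj (d := d)) :=
  continuous_tensor3021 (continuous_dproj continuous_coe_SU.matrix_conjTranspose)
    (continuous_dproj (continuous_conjM continuous_coe_SU))

/-- The partial transposition in the link product is what turns `|U⟩⟩_{21}` into `|U^*⟩⟩_{21}` in
`combProj`. -/
lemma dotProduct_plug (C : Matrix (Wires d) (Wires d) ℂ) (U : SU d) :
    star (dket U.1ᴴ) ⬝ᵥ (plug C (dproj U.1) *ᵥ dket U.1ᴴ) = (C * combProj U).trace := by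
  have h : (C * combProj U).trace = ∑ w, ∑ v, C w v * (combKet U v * star (combKet U w)) := by
    simp only [trace, diag_apply, mul_apply, combProj_eq_vecMulVec, vecMulVec_apply, Pi.star_apply]
  have e : ∀ f : Wires d → ℂ, ∑ w, f w = ∑ a : Fin d × Fin d, ∑ k : Fin d × Fin d,
      f (a.1, k.1, k.2, a.2) := by
    intro f
    rw [← (group3021 d).symm.sum_comp, Fintype.sum_prod_type]
    rfl
  rw [h, e]
  simp only [e, dotProduct, mulVec, Pi.star_apply, plug_apply, Finset.mul_sum, Finset.sum_mul]
  refine Finset.sum_congr rfl fun a _ => ?_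
  conv_rhs => rw [Finset.sum_comm]
  refine Finset.sum_congr rfl fun b _ => ?_
  conv_rhs => rw [Finset.sum_comm]
  refine Finset.sum_congr rfl fun y _ => Finset.sum_congr rfl fun k _ => ?_
  simp only [combKet_apply, dket, dproj, vecMulVec_apply, Pi.star_apply, conjTranspose_apply,
    star_mul', star_star]
  ring

lemma dotProduct_dket_SU (U : SU d) : star (dket U.1ᴴ) ⬝ᵥ dket U.1ᴴ = d := by
  have h := congrArg trace (SU_mul_conjTranspose U)
  rw [trace_one, Fintype.card_fin] at h
  rw [← h]
  simp only [trace, diag_apply, mul_apply, dotProduct, Pi.star_apply, dket, conjTranspose_apply,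
    star_star, Fintype.sum_prod_type]
  exact Finset.sum_comm

lemma inversionFidelity_eq (hd : d ≠ 0) {C : Matrix (Wires d) (Wires d) ℂ} (hC : C.PosSemidef)
    (U : SU d) : inversionFidelity C U = ((d : ℝ) ^ 2)⁻¹ * (C * combProj U).trace.re := by
  have hd0 : (0 : ℝ) ≤ d := Nat.cast_nonneg d
  -- The norm squared of `|U†⟩⟩` is `d`. This normalization accounts for one factor `d⁻¹`, and the
  -- one of the Choi operator of the circuit for the other.
  set ψ : Fin d × Fin d → ℂ := (((Real.sqrt d)⁻¹ : ℝ) : ℂ) • dket U.1ᴴ with hψ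
  have hss : ((((Real.sqrt d)⁻¹ : ℝ) : ℂ)) * (((Real.sqrt d)⁻¹ : ℝ) : ℂ) = (d : ℂ)⁻¹ := by
    rw [← Complex.ofReal_mul, ← mul_inv, Real.mul_self_sqrt hd0]
    simp
  have hst : star ψ = (((Real.sqrt d)⁻¹ : ℝ) : ℂ) • star (dket U.1ᴴ) := by
    rw [hψ, star_smul]
    simp
  have h1 : (d : ℂ)⁻¹ • dproj U.1ᴴ = vecMulVec ψ (star ψ) := by
    rw [hst, hψ, smul_vecMulVec, vecMulVec_smul, smul_smul, hss, dproj]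
  have h2 : star ψ ⬝ᵥ ψ = 1 := by
    rw [hst, hψ, smul_dotProduct, dotProduct_smul, smul_smul, hss, dotProduct_dket_SU, smul_eq_mul,
      inv_mul_cancel₀ (Nat.cast_ne_zero.mpr hd)]
  have h3 : ((d : ℂ)⁻¹ • plug C (dproj U.1)).PosSemidef :=
    (posSemidef_plug_dproj hC U.1).smul (by positivity)
  rw [inversionFidelity, channelFidelity, h1, stateFidelity_pure h3 h2, hst, hψ, smul_mulVec,
    mulVec_smul, smul_dotProduct, dotProduct_smul, dotProduct_smul, dotProduct_plug, smul_smul,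
    smul_smul, mul_right_comm, hss, smul_eq_mul]
  have : (d : ℂ)⁻¹ * (d : ℂ)⁻¹ = ((((d : ℝ) ^ 2)⁻¹ : ℝ) : ℂ) := by
    push_cast
    ring
  rw [this, Complex.re_ofReal_mul]

lemma continuous_trace_mul_combProj (C : Matrix (Wires d) (Wires d) ℂ) :
    Continuous fun U : SU d => (C * combProj U).trace :=
  (continuous_const.matrix_mul continuous_combProj).matrix_trace

lemma integrable_inversionFidelity (hd : d ≠ 0) {C : Matrix (Wires d) (Wires d) ℂ}
    (hC : C.PosSemidef) : Integrable (fun U : SU d => inversionFidelity C U) (haarSU d) := by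
  simp only [inversionFidelity_eq hd hC]
  exact ((integrable_of_continuous_SU (continuous_trace_mul_combProj C)).re).const_mul _

lemma averageFidelity_eq (hd : d ≠ 0) {C : Matrix (Wires d) (Wires d) ℂ} (hC : C.PosSemidef) :
    averageFidelity C = ((d : ℝ) ^ 2)⁻¹ * (C * haarAvg (combProj (d := d))).trace.re := by
  have h := functional_haarAvg (traceMulLin C) (continuous_combProj (d := d))
  simp only [traceMulLin, LinearMap.coe_mk, AddHom.coe_mk, trace_mul_comm _ C] at h
  rw [h, averageFidelity]
  simp only [inversionFidelity_eq hd hC]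
  rw [integral_const_mul]
  congr 1
  exact integral_re (integrable_of_continuous_SU (continuous_trace_mul_combProj C))

end Fidelity

/-! ### Covariance of the average -/

section AverageCovariance

variable {d : ℕ}

lemma tensor3021_mul (A B A' B' : Matrix (Fin d × Fin d) (Fin d × Fin d) ℂ) :
    tensor3021 A B * tensor3021 A' B' = tensor3021 (A * A') (B * B') := by
  simp only [tensor3021, submatrix_mul_equiv, mul_kronecker_mul]

lemma tensor3021_conjTranspose (A B : Matrix (Fin d × Fin d) (Fin d × Fin d) ℂ) :
    (tensor3021 A B)ᴴ = tensor3021 Aᴴ Bᴴ := by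
  simp only [tensor3021, conjTranspose_submatrix, conjTranspose_kronecker]

lemma symmetryOp_eq_tensor3021 (V W : SU d) :
    symmetryOp V W = tensor3021 (V.1 ⊗ₖ W.1) (W.1 ⊗ₖ V.1) := by
  ext w v
  simp only [symmetryOp, tensor3021, kroneckerMap_apply, submatrix_apply, group3021,
    Equiv.coe_fn_mk]
  ring

lemma kronecker_mulVec_dket {m n p q : Type*} [Fintype m] [Fintype n] (A : Matrix p m ℂ)
    (B : Matrix q n ℂ) (X : Matrix m n ℂ) : (A ⊗ₖ B) *ᵥ dket X = dket (A * X * Bᵀ) := by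
  ext ⟨i, j⟩
  simp only [mulVec, dotProduct, dket, kroneckerMap_apply, Fintype.sum_prod_type, mul_apply,
    transpose_apply, Finset.sum_mul]
  rw [Finset.sum_comm]
  refine Finset.sum_congr rfl fun _ _ => Finset.sum_congr rfl fun _ _ => ?_
  ring

lemma kronecker_conj_dproj {m n p q : Type*} [Fintype m] [Fintype n] (A : Matrix p m ℂ)
    (B : Matrix q n ℂ) (X : Matrix m n ℂ) :
    (A ⊗ₖ B) * dproj X * (A ⊗ₖ B)ᴴ = dproj (A * X * Bᵀ) := by
  rw [dproj, dproj, mul_vecMulVec, vecMulVec_mul, ← kronecker_mulVec_dket, star_mulVec]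

/-- The entrywise complex conjugate of an element of `SU(d)`. -/
def conjSU (W : SU d) : SU d :=
  ⟨conjM W.1, by
    have h := mem_specialUnitaryGroup_iff.mp W.2
    rw [mem_specialUnitaryGroup_iff, mem_unitaryGroup_iff]
    have e : conjM W.1 = (starRingEnd ℂ).mapMatrix W.1 := rfl
    refine ⟨?_, ?_⟩
    · have h2 := congrArg (starRingEnd ℂ).mapMatrix (mem_unitaryGroup_iff.mp h.1)
      rw [map_mul, map_one] at h2
      exact h2
    · rw [e, ← RingHom.map_det, h.2, map_one]⟩

lemma conjM_eq_transpose_conjTranspose {m n : Type*} (A : Matrix m n ℂ) : conjM A = Aᴴᵀ := rfl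

lemma conjM_mul {m n p : Type*} [Fintype n] (A : Matrix m n ℂ) (B : Matrix n p ℂ) :
    conjM (A * B) = conjM A * conjM B := by
  simp only [conjM_eq_transpose_conjTranspose, conjTranspose_mul, transpose_mul]

lemma conjM_conjM {m n : Type*} (A : Matrix m n ℂ) : conjM (conjM A) = A := by
  ext i j
  simp [conjM]

lemma conjTranspose_conjM {m n : Type*} (A : Matrix m n ℂ) : (conjM A)ᴴ = Aᵀ := by
  ext i j
  simp [conjM]

lemma conjM_conjTranspose {m n : Type*} (A : Matrix m n ℂ) : conjM Aᴴ = Aᵀ := by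
  ext i j
  simp [conjM]

/-- On `30` the vector becomes `|V U† Wᵀ⟩⟩` and on `21` it becomes `|W U^* Vᵀ⟩⟩`; these are the
adjoint and the conjugate of the same matrix `W^* U V†`. -/
lemma combProj_conj_symmetryOp (U V W : SU d) :
    symmetryOp V W * combProj U * (symmetryOp V W)ᴴ = combProj (conjSU W * U * V⁻¹) := by
  have hV : (V⁻¹ : SU d).1 = V.1ᴴ := rfl
  have h : ((conjSU W * U * V⁻¹ : SU d)).1 = conjM W.1 * U.1 * V.1ᴴ := rfl
  rw [symmetryOp_eq_tensor3021, combProj, combProj, tensor3021_conjTranspose, tensor3021_mul,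
    tensor3021_mul, kronecker_conj_dproj, kronecker_conj_dproj, h]
  simp only [conjM_mul, conjTranspose_mul, conjTranspose_conjTranspose, conjM_conjM]
  rw [← Matrix.mul_assoc, conjTranspose_conjM, conjM_conjTranspose]

lemma isCovariant_haarAvg_combProj : IsCovariant (haarAvg (combProj (d := d))) := by
  intro V W
  refine commute_of_conj_eq (symmetryOp_conjTranspose_mul V W) ?_
  rw [mul_haarAvg_mul _ _ continuous_combProj]
  simp only [combProj_conj_symmetryOp]
  simp only [mul_assoc (conjSU W)]
  rw [haarAvg_mul_right (fun U => combProj (conjSU W * U)) V⁻¹, haarAvg_mul_left combProj]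

end AverageCovariance

/-! ### Combinations of the permutations -/

section PermComb

variable {d : ℕ}

lemma permComb_apply (x y z t : ℂ) (a b c e a' b' c' e' : Fin d) :
    permComb d x y z t (a, b, c, e) (a', b', c', e') =
    x * ((if a = a' ∧ c = c' then 1 else 0) * (if b = b' ∧ e = e' then 1 else 0)) +
    y * ((if a = c' ∧ c = a' then 1 else 0) * (if b = b' ∧ e = e' then 1 else 0)) +
    z * ((if a = a' ∧ c = c' then 1 else 0) * (if b = e' ∧ e = b' then 1 else 0)) +
    t * ((if a = c' ∧ c = a' then 1 else 0) * (if b = e' ∧ e = b' then 1 else 0)) := by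
  simp only [permComb, tensor3120, Matrix.add_apply, Matrix.smul_apply, submatrix_apply,
    kroneckerMap_apply, smul_eq_mul, one_apply, swapOp_apply, group3120, Equiv.coe_fn_mk,
    Prod.mk.injEq]

lemma tensor3120_mul (A B A' B' : Matrix (Fin d × Fin d) (Fin d × Fin d) ℂ) :
    tensor3120 A B * tensor3120 A' B' = tensor3120 (A * A') (B * B') := by
  simp only [tensor3120, submatrix_mul_equiv, mul_kronecker_mul]

lemma trace_tensor3120 (A B : Matrix (Fin d × Fin d) (Fin d × Fin d) ℂ) :
    (tensor3120 A B).trace = A.trace * B.trace := by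
  rw [← trace_kronecker]
  exact (group3120 d).sum_comp fun i => (A ⊗ₖ B) i i

lemma swapOp_mul_swapOp : swapOp d * swapOp d = 1 := by
  ext ⟨a, b⟩ ⟨p, q⟩
  simp only [mul_apply, swapOp_apply, Fintype.sum_prod_type, one_apply, Prod.mk.injEq, ite_and,
    mul_ite, mul_one, mul_zero]
  rw [Finset.sum_eq_single b (by intro u _ hu; simp [hu.symm]) (by simp),
    Finset.sum_eq_single a (by intro u _ hu; simp [hu.symm]) (by simp)]
  split_ifs <;> simp_all

lemma trace_swapOp : (swapOp d).trace = d := by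
  simp [trace, swapOp_apply, Fintype.sum_prod_type, ite_and]

lemma trace_one_prod : (1 : Matrix (Fin d × Fin d) (Fin d × Fin d) ℂ).trace = (d : ℂ) ^ 2 := by
  rw [trace_one, Fintype.card_prod, Fintype.card_fin]
  push_cast
  ring

/-- The two swaps commute and square to one, so this is multiplication in the group algebra of the
Klein four-group. -/
lemma permComb_mul (x y z t x' y' z' t' : ℂ) :
    permComb d x y z t * permComb d x' y' z' t' =
      permComb d (x * x' + y * y' + z * z' + t * t') (x * y' + y * x' + z * t' + t * z')
        (x * z' + z * x' + y * t' + t * y') (x * t' + t * x' + y * z' + z * y') := by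
  simp only [permComb, Matrix.add_mul, Matrix.mul_add, Matrix.smul_mul, Matrix.mul_smul,
    tensor3120_mul, swapOp_mul_swapOp, Matrix.one_mul, Matrix.mul_one]
  module

lemma trace_permComb (x y z t : ℂ) :
    (permComb d x y z t).trace = x * d ^ 4 + (y + z) * d ^ 3 + t * d ^ 2 := by
  simp only [permComb, trace_add, trace_smul, trace_tensor3120, trace_swapOp, trace_one_prod,
    smul_eq_mul]
  ring

lemma traceLeft_permComb (x y z t : ℂ) (b c e b' c' e' : Fin d) :
    traceLeft (permComb d x y z t) (b, c, e) (b', c', e') = (if c = c' then 1 else 0) *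
      ((x * d + y) * (if b = b' ∧ e = e' then 1 else 0) +
      (z * d + t) * (if b = e' ∧ e = b' then 1 else 0)) := by
  have h : ∑ i : Fin d, (if i = c' ∧ c = i then (1 : ℂ) else 0) = if c = c' then 1 else 0 := by
    simp [ite_and]
  simp only [traceLeft_apply, permComb_apply, Finset.sum_add_distrib, ← Finset.mul_sum, true_and]
  simp only [← Finset.sum_mul, h]
  rw [Finset.sum_const, Finset.sum_const, Finset.card_univ, Fintype.card_fin, nsmul_eq_mul,
    nsmul_eq_mul]
  ring

end PermComb

/-! ### The optimal comb -/

section OptimalComb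

variable {d : ℕ}

lemma optimalComb_eq_permComb (hd : 2 ≤ d) : optimalComb d = permComb d
    (((d : ℂ) ^ 2 - 1)⁻¹) (-((d : ℂ) * ((d : ℂ) ^ 2 - 1))⁻¹) (-((d : ℂ) * ((d : ℂ) ^ 2 - 1))⁻¹)
    (((d : ℂ) ^ 2 - 1)⁻¹) := by
  have h0 : (d : ℂ) ≠ 0 := Nat.cast_ne_zero.mpr (by omega)
  have h1 : (d : ℂ) - 1 ≠ 0 := by
    rw [sub_ne_zero]
    exact_mod_cast (by omega : d ≠ 1)
  have h2 : (d : ℂ) + 1 ≠ 0 := by exact_mod_cast (by omega : d + 1 ≠ 0)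
  have h3 : (d : ℂ) ^ 2 - 1 = (d - 1) * (d + 1) := by ring
  have hp : (projSym d).trace = (d : ℂ) * (d + 1) / 2 := by
    simp only [projSym, trace_smul, trace_add, trace_one_prod, trace_swapOp, smul_eq_mul]
    ring
  have hm : (projAnti d).trace = (d : ℂ) * (d - 1) / 2 := by
    simp only [projAnti, trace_smul, trace_sub, trace_one_prod, trace_swapOp, smul_eq_mul]
    ring
  rw [optimalComb, hp, hm, h3]
  ext w v
  simp only [permComb, tensor3120, projSym, projAnti, Matrix.add_apply, Matrix.smul_apply,
    Matrix.sub_apply, submatrix_apply, kroneckerMap_apply, smul_eq_mul]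
  field_simp
  ring

lemma traceLeft_combProj (U : SU d) (b c e b' c' e' : Fin d) :
    traceLeft (combProj U) (b, c, e) (b', c', e') = star (U.1 b c) * U.1 b' c' *
      (1 : Matrix (Fin d) (Fin d) ℂ) e' e := by
  rw [← SU_mul_conjTranspose U]
  simp only [traceLeft_apply, combProj_eq_vecMulVec, vecMulVec_apply, Pi.star_apply,
    combKet_apply, mul_apply, conjTranspose_apply, star_mul', star_star, Finset.mul_sum]
  refine Finset.sum_congr rfl fun i _ => ?_
  ring

lemma traceLeft_traceLeft_combProj (U : SU d) : traceLeft (traceLeft (combProj U)) = 1 := by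
  ext ⟨c, e⟩ ⟨c', e'⟩
  have h := entry_eq (SU_conjTranspose_mul U) c c'
  simp only [mul_apply, conjTranspose_apply] at h
  rw [traceLeft_apply]
  simp only [traceLeft_combProj]
  rw [← Finset.sum_mul, h]
  simp only [one_apply, Prod.mk.injEq, ite_and, mul_ite, mul_one, mul_zero, eq_comm (a := e)]
  split_ifs <;> rfl

/-- Covariance leaves four unknown coefficients, and four linear equations determine them. -/
lemma haarAvg_combProj (hd : 2 ≤ d) : haarAvg (combProj (d := d)) = optimalComb d := by
  obtain ⟨x, y, z, t, h⟩ := (isCovariant_haarAvg_combProj (d := d)).exists_eq_permComb hd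
  let r : Fin d := ⟨0, by omega⟩
  let s : Fin d := ⟨1, by omega⟩
  have hrs : r ≠ s := by simp [r, s]
  -- The entry of `combKet` is a product of two conjugated entries of `U`, which exchanging `3` with
  -- `0`'s partner wire `1` and `2` with `0` merely permutes. Invariance under this simultaneous
  -- swap forces `x = t` and `y = z`.
  have hsymm : ∀ (a b e f : Fin d) (v : Wires d),
      haarAvg (combProj (d := d)) (a, b, e, f) v = haarAvg (combProj (d := d)) (e, f, a, b) v := by
    intro a b e f v
    simp only [haarAvg_apply, combProj_eq_vecMulVec, vecMulVec_apply, combKet_apply,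
      mul_comm (star (_ : ℂ)) (star _)]
  have hxt : x = t := by
    simpa [h, permComb_apply, hrs, hrs.symm] using hsymm r r s s (r, r, s, s)
  have hyz : y = z := by
    simpa [h, permComb_apply, hrs, hrs.symm] using hsymm s r r s (r, r, s, s)
  have h1 := map_haarAvg (traceLeftLin (Fin d) (Fin d × Fin d × Fin d))
    (continuous_combProj (d := d))
  have hc1 := continuous_linearMap_comp (traceLeftLin (Fin d) (Fin d × Fin d × Fin d))
    (continuous_combProj (d := d))
  have h2 := map_haarAvg (traceLeftLin (Fin d) (Fin d × Fin d)) hc1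
  -- The trace over `3` of every `combProj U` is diagonal in wire `0`, so the swap of `20` cannot
  -- appear in it.
  have h3 : z * d + t = 0 := by
    have h4 := entry_eq h1 (r, r, s) (s, r, r)
    simp only [traceLeftLin, LinearMap.coe_mk, AddHom.coe_mk, haarAvg_apply,
      traceLeft_combProj] at h4
    simpa [h, traceLeft_permComb, hrs, hrs.symm] using h4
  -- The trace over `3` and `2` of every `combProj U` is the identity; this is its entry at `((r,
  -- r), (r, r))`.
  have h5 : (x * d + y) * d + (z * d + t) = 1 := by
    rw [← h1] at h2
    have h4 := entry_eq h2 (r, r) (r, r)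
    simp only [traceLeftLin, LinearMap.coe_mk, AddHom.coe_mk, haarAvg_apply,
      traceLeft_traceLeft_combProj, h] at h4
    rw [traceLeft_apply] at h4
    simp [traceLeft_permComb, Finset.sum_add_distrib, ite_and] at h4
    linear_combination h4
  have h0 : (d : ℂ) ≠ 0 := Nat.cast_ne_zero.mpr (by omega)
  have hne : (d : ℂ) ^ 2 - 1 ≠ 0 := by
    have h6 : (d : ℂ) - 1 ≠ 0 := by
      rw [sub_ne_zero]
      exact_mod_cast (by omega : d ≠ 1)
    have h7 : (d : ℂ) + 1 ≠ 0 := by exact_mod_cast (by omega : d + 1 ≠ 0)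
    rw [show (d : ℂ) ^ 2 - 1 = (d - 1) * (d + 1) by ring]
    exact mul_ne_zero h6 h7
  have hz : z = -((d : ℂ) * ((d : ℂ) ^ 2 - 1))⁻¹ := by
    rw [← neg_eq_iff_eq_neg]
    refine eq_inv_of_mul_eq_one_left ?_
    rw [hxt, hyz] at h5
    linear_combination h5 - (d ^ 2 + 1) * h3
  have ht : t = ((d : ℂ) ^ 2 - 1)⁻¹ := by
    have : t = -(z * d) := by linear_combination h3
    rw [this, hz]
    field_simp
  rw [h, optimalComb_eq_permComb hd, hxt, hyz, hz, ht]

lemma traceLeft_optimalComb (hd : 2 ≤ d) : traceLeft (optimalComb d) =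
    (1 : Matrix (Fin d) (Fin d) ℂ) ⊗ₖ
      ((d : ℂ)⁻¹ • (1 : Matrix (Fin d × Fin d) (Fin d × Fin d) ℂ)) := by
  have h0 : (d : ℂ) ≠ 0 := Nat.cast_ne_zero.mpr (by omega)
  have hne : (d : ℂ) ^ 2 - 1 ≠ 0 := by
    rw [sub_ne_zero]
    exact_mod_cast (by nlinarith : d ^ 2 ≠ 1)
  have e1 : ((d : ℂ) ^ 2 - 1)⁻¹ * d + -((d : ℂ) * ((d : ℂ) ^ 2 - 1))⁻¹ = (d : ℂ)⁻¹ := by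
    field_simp
    ring
  have e2 : -((d : ℂ) * ((d : ℂ) ^ 2 - 1))⁻¹ * (d : ℂ) + ((d : ℂ) ^ 2 - 1)⁻¹ = 0 := by
    field_simp
    ring
  ext ⟨b, c, e⟩ ⟨b', c', e'⟩
  rw [optimalComb_eq_permComb hd, traceLeft_permComb, e1, e2]
  simp only [kroneckerMap_apply, Matrix.smul_apply, one_apply, Prod.ext_iff, smul_eq_mul]
  simp only [ite_and]
  split_ifs <;> simp

lemma reducedComb_optimalComb (hd : 2 ≤ d) : reducedComb (optimalComb d) =
    (d : ℂ)⁻¹ • (1 : Matrix (Fin d × Fin d) (Fin d × Fin d) ℂ) := by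
  rw [reducedComb, traceLeft_optimalComb hd, traceLeft_one_kronecker, Fintype.card_fin, smul_smul,
    inv_mul_cancel₀ (Nat.cast_ne_zero.mpr (by omega)), one_smul]

lemma posSemidef_combProj (U : SU d) : (combProj U).PosSemidef := by
  rw [combProj_eq_vecMulVec]
  exact posSemidef_vecMulVec_self_star _

lemma posSemidef_optimalComb (hd : 2 ≤ d) : (optimalComb d).PosSemidef := by
  rw [← haarAvg_combProj hd]
  exact posSemidef_haarAvg continuous_combProj posSemidef_combProj

lemma isCovariant_optimalComb (hd : 2 ≤ d) : IsCovariant (optimalComb d) := by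
  rw [← haarAvg_combProj hd]
  exact isCovariant_haarAvg_combProj

lemma isOneSlotComb_optimalComb (hd : 2 ≤ d) : IsOneSlotComb (optimalComb d) := by
  refine ⟨posSemidef_optimalComb hd, _, traceLeft_optimalComb hd, ?_⟩
  rw [← one_kronecker_one (m := Fin d) (n := Fin d), ← kronecker_smul, traceLeft_one_kronecker,
    Fintype.card_fin, smul_smul, mul_inv_cancel₀ (Nat.cast_ne_zero.mpr (by omega)), one_smul]

end OptimalComb

/-! ### Optimality -/

section Optimality

variable {d : ℕ}

lemma averageFidelity_eq_trace (hd : 2 ≤ d) {C : Matrix (Wires d) (Wires d) ℂ}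
    (hC : C.PosSemidef) :
    averageFidelity C = ((d : ℝ) ^ 2)⁻¹ * (C * optimalComb d).trace.re := by
  rw [averageFidelity_eq (by omega) hC, haarAvg_combProj hd]

lemma averageFidelity_twirl (hd : 2 ≤ d) {C : Matrix (Wires d) (Wires d) ℂ}
    (hC : IsOneSlotComb C) : averageFidelity (twirl C) = averageFidelity C := by
  rw [averageFidelity_eq_trace hd hC.1, averageFidelity_eq_trace hd (hC.twirl (by omega)).1,
    trace_twirl_mul (isCovariant_optimalComb hd)]

lemma trace_permComb_mul_optimalComb (hd : 2 ≤ d) (x y z t : ℂ) :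
    (permComb d x y z t * optimalComb d).trace = (x + t) * d ^ 2 + (y + z) * d := by
  have h0 : (d : ℂ) ≠ 0 := Nat.cast_ne_zero.mpr (by omega)
  have hne : (d : ℂ) ^ 2 - 1 ≠ 0 := by
    rw [sub_ne_zero]
    exact_mod_cast (by nlinarith : d ^ 2 ≠ 1)
  rw [optimalComb_eq_permComb hd, permComb_mul, trace_permComb]
  field_simp
  ring

/-- The constraints that the comb conditions put on the coefficients of a covariant comb. -/
lemma covariant_comb_bounds (hd : 2 ≤ d) {x y z t : ℂ} (hC : IsOneSlotComb (permComb d x y z t)) :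
    z * d + t = 0 ∧ (x * d + y) * d = 1 ∧ 0 ≤ x + y - z - t ∧ 0 ≤ x - y + z - t := by
  let r : Fin d := ⟨0, by omega⟩
  let s : Fin d := ⟨1, by omega⟩
  have hrs : r ≠ s := by simp [r, s]
  obtain ⟨hp, h1, h2⟩ := (isOneSlotComb_iff (by omega)).mp hC
  -- This entry is off-diagonal in wire `2`, so it vanishes in `I_2 ⊗ C⁽¹⁾`, while the swap of `20`
  -- contributes to it.
  have h3 : z * d + t = 0 := by
    simpa [traceLeft_permComb, hrs, hrs.symm] using entry_eq h1 (r, r, s) (s, r, r)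
  refine ⟨h3, ?_, ?_, ?_⟩
  · have h6 : ∀ i : Fin d, reducedComb (permComb d x y z t) (i, r) (i, r) = x * d + y := by
      intro i
      have := entry_eq h1 (s, i, r) (s, i, r)
      simpa [traceLeft_permComb, hrs, hrs.symm] using this.symm
    have h7 := entry_eq h2 r r
    rw [traceLeft_apply] at h7
    simp [h6] at h7
    linear_combination h7
  · have h := hp.dotProduct_mulVec_nonneg (Pi.single (r, r, r, s) 1 - Pi.single (r, s, r, r) 1)
    simp [mulVec_sub, sub_dotProduct, dotProduct_sub, permComb_apply, hrs, hrs.symm] at h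
    rw [Complex.le_def] at h ⊢
    simp at h ⊢
    constructor <;> linarith
  · have h := hp.dotProduct_mulVec_nonneg (Pi.single (r, r, s, r) 1 - Pi.single (s, r, r, r) 1)
    simp [mulVec_sub, sub_dotProduct, dotProduct_sub, permComb_apply, hrs, hrs.symm] at h
    rw [Complex.le_def] at h ⊢
    simp at h ⊢
    constructor <;> linarith

lemma averageFidelity_permComb (hd : 2 ≤ d) {x y z t : ℂ}
    (hC : IsOneSlotComb (permComb d x y z t)) :
    averageFidelity (permComb d x y z t) = (1 - (d * (d ^ 2 - 1)) * z.re) / (d : ℝ) ^ 2 := by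
  obtain ⟨h1, h2, -, -⟩ := covariant_comb_bounds hd hC
  have e : (x + t) * (d : ℂ) ^ 2 + (y + z) * d = 1 - ((d * (d ^ 2 - 1) : ℝ) : ℂ) * z := by
    push_cast
    linear_combination h2 + d ^ 2 * h1
  rw [averageFidelity_eq_trace hd hC.1, trace_permComb_mul_optimalComb hd, e, Complex.sub_re,
    Complex.re_ofReal_mul, Complex.one_re, inv_mul_eq_div]

lemma covariant_comb_coeff (hd : 2 ≤ d) {x y z t : ℂ} (hC : IsOneSlotComb (permComb d x y z t)) :
    -1 ≤ (d * (d ^ 2 - 1) : ℝ) * z.re ∧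
      ((d * (d ^ 2 - 1) : ℝ) * z.re = -1 → permComb d x y z t = optimalComb d) := by
  obtain ⟨h1, h2, h3, h4⟩ := covariant_comb_bounds hd hC
  have hd2 : (2 : ℝ) ≤ d := by exact_mod_cast hd
  have h0 : (d : ℂ) ≠ 0 := Nat.cast_ne_zero.mpr (by omega)
  have hne : (d : ℂ) ^ 2 - 1 ≠ 0 := by
    rw [sub_ne_zero]
    exact_mod_cast (by nlinarith : d ^ 2 ≠ 1)
  have ht : t = -(d * z) := by linear_combination h1
  have h3' : 0 ≤ ((d : ℝ) : ℂ) * (x + y - z - t) :=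
    mul_nonneg (Complex.zero_le_real.mpr (by linarith)) h3
  have h4' : 0 ≤ ((d : ℝ) : ℂ) * (x - y + z - t) :=
    mul_nonneg (Complex.zero_le_real.mpr (by linarith)) h4
  -- The normalization conditions eliminate `y` and `t`; the factor `d` avoids a division.
  have e3 : ((d : ℝ) : ℂ) * (x + y - z - t) = 1 - ((d * (d - 1) : ℝ) : ℂ) * (x - z) := by
    push_cast
    linear_combination h2 - d * ht
  have e4 : ((d : ℝ) : ℂ) * (x - y + z - t) = ((d * (d + 1) : ℝ) : ℂ) * (x + z) - 1 := by
    push_cast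
    linear_combination -h2 - d * ht
  rw [e3, Complex.nonneg_iff, Complex.sub_re, Complex.sub_im, Complex.re_ofReal_mul,
    Complex.im_ofReal_mul, Complex.one_re, Complex.one_im, Complex.sub_re, Complex.sub_im] at h3'
  rw [e4, Complex.nonneg_iff, Complex.sub_re, Complex.sub_im, Complex.re_ofReal_mul,
    Complex.im_ofReal_mul, Complex.one_re, Complex.one_im, Complex.add_re, Complex.add_im] at h4'
  obtain ⟨h3r, h3i⟩ := h3'
  obtain ⟨h4r, h4i⟩ := h4'
  -- The weights `d + 1` and `d - 1` equalize the coefficients of `x`, so comparing the two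
  -- inequalities eliminates `x` and bounds `z` from below. At the extremal `z` they bound `x` from
  -- both sides by the same value.
  have hA : (d + 1 : ℝ) * (d * (d - 1) * (x.re - z.re)) ≤ d + 1 := by nlinarith
  have hB : (d - 1 : ℝ) ≤ (d - 1 : ℝ) * (d * (d + 1) * (x.re + z.re)) := by nlinarith
  refine ⟨by nlinarith, fun hz => ?_⟩
  have hxr : (d ^ 2 - 1 : ℝ) * x.re = 1 := by
    have hl : (d : ℝ) * ((d ^ 2 - 1) * x.re) = d * 1 := by
      apply le_antisymm <;> nlinarith
    exact mul_left_cancel₀ (by positivity) hl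
  -- Nonnegativity in `ℂ` includes being real, which makes `x - z` and, below, `x + z` real.
  have hi1 : x.im - z.im = 0 := by
    have : (d * (d - 1) : ℝ) * (x.im - z.im) = 0 := by linarith
    rcases mul_eq_zero.mp this with h | h
    · nlinarith
    · exact h
  have hi2 : x.im + z.im = 0 := by
    have : (d * (d + 1) : ℝ) * (x.im + z.im) = 0 := by linarith
    rcases mul_eq_zero.mp this with h | h
    · nlinarith
    · exact h
  have hx : ((d : ℂ) ^ 2 - 1) * x = 1 := by
    have hxre : x = (x.re : ℂ) := Complex.ext rfl (by simp; linarith)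
    rw [hxre]
    exact_mod_cast hxr
  have hzc : ((d : ℂ) * (d ^ 2 - 1)) * z = -1 := by
    have hzre : z = (z.re : ℂ) := Complex.ext rfl (by simp; linarith)
    rw [hzre]
    exact_mod_cast hz
  have hx' : x = ((d : ℂ) ^ 2 - 1)⁻¹ := eq_inv_of_mul_eq_one_right hx
  have hz' : z = -((d : ℂ) * ((d : ℂ) ^ 2 - 1))⁻¹ := by
    rw [← neg_eq_iff_eq_neg]
    refine eq_inv_of_mul_eq_one_left ?_
    linear_combination -hzc
  have ht' : t = ((d : ℂ) ^ 2 - 1)⁻¹ := by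
    refine eq_inv_of_mul_eq_one_left ?_
    linear_combination (d ^ 2 - 1) * ht - hzc
  have hy' : y = -((d : ℂ) * ((d : ℂ) ^ 2 - 1))⁻¹ := by
    rw [← neg_eq_iff_eq_neg]
    refine eq_inv_of_mul_eq_one_left ?_
    linear_combination -(d ^ 2 - 1 : ℂ) * h2 + d ^ 2 * hx
  rw [optimalComb_eq_permComb hd, hx', hy', hz', ht']

lemma averageFidelity_le_of_isCovariant (hd : 2 ≤ d) {C : Matrix (Wires d) (Wires d) ℂ}
    (hC : IsOneSlotComb C) (hcov : IsCovariant C) : averageFidelity C ≤ 2 / (d : ℝ) ^ 2 := by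
  obtain ⟨x, y, z, t, rfl⟩ := hcov.exists_eq_permComb hd
  rw [averageFidelity_permComb hd hC]
  have h := (covariant_comb_coeff hd hC).1
  gcongr
  linarith

lemma averageFidelity_optimalComb (hd : 2 ≤ d) :
    averageFidelity (optimalComb d) = 2 / (d : ℝ) ^ 2 := by
  have hC := isOneSlotComb_optimalComb hd
  have hd2 : (2 : ℝ) ≤ d := by exact_mod_cast hd
  have hne : (d * (d ^ 2 - 1) : ℝ) ≠ 0 :=
    (mul_pos (by linarith : (0 : ℝ) < d) (by nlinarith : (0 : ℝ) < d ^ 2 - 1)).ne'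
  have e : (-((d : ℂ) * ((d : ℂ) ^ 2 - 1))⁻¹).re = -(d * (d ^ 2 - 1) : ℝ)⁻¹ := by
    rw [← Complex.ofReal_re (-(d * (d ^ 2 - 1) : ℝ)⁻¹)]
    push_cast
    rfl
  rw [optimalComb_eq_permComb hd] at hC ⊢
  rw [averageFidelity_permComb hd hC, e, mul_neg, mul_inv_cancel₀ hne]
  norm_num

lemma averageFidelity_eq_iff_of_isCovariant (hd : 2 ≤ d) {C : Matrix (Wires d) (Wires d) ℂ}
    (hC : IsOneSlotComb C) (hcov : IsCovariant C) :
    averageFidelity C = 2 / (d : ℝ) ^ 2 ↔ C = optimalComb d := by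
  refine ⟨fun h => ?_, fun h => h ▸ averageFidelity_optimalComb hd⟩
  obtain ⟨x, y, z, t, rfl⟩ := hcov.exists_eq_permComb hd
  refine (covariant_comb_coeff hd hC).2 ?_
  have hd2 : ((d : ℝ) ^ 2) ≠ 0 := by
    have : d ≠ 0 := by omega
    positivity
  rw [averageFidelity_permComb hd hC, div_left_inj' hd2] at h
  linarith

end Optimality

/-! ### Entrywise conjugation -/

lemma conjM_smul_one {m : Type*} [DecidableEq m] (r : ℝ) :
    conjM (((r : ℝ) : ℂ) • (1 : Matrix m m ℂ)) =
    ((r : ℝ) : ℂ) • (1 : Matrix m m ℂ) := by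
  rw [conjM_eq_transpose_conjTranspose, conjTranspose_smul, conjTranspose_one, transpose_smul,
    transpose_one]
  congr 1
  exact Complex.conj_ofReal r

lemma PosSemidef.conjM {m : Type*} {D : Matrix m m ℂ} (hD : D.PosSemidef) : (conjM D).PosSemidef := by
  rw [conjM_eq_transpose_conjTranspose]
  exact hD.conjTranspose.transpose

/-! ### Functional calculus of positive matrices -/

section FunctionalCalculus

variable {m : Type*} [Fintype m] [DecidableEq m]

/-- The spectrum is finite, so even functions discontinuous at zero, such as those defining
`invSqrt` and `suppProj`, are admissible in the functional calculus. -/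
lemma continuousOn_spectrum (D : Matrix m m ℂ) (f : ℝ → ℝ) :
    ContinuousOn f (spectrum ℝ D) := D.finite_real_spectrum.continuousOn f

lemma sqrt_eq_cfc_real {D : Matrix m m ℂ} (hD : D.PosSemidef) :
    CFC.sqrt D = cfc Real.sqrt D := by
  refine CFC.sqrt_unique ?_ (cfc_nonneg fun x _ => Real.sqrt_nonneg x)
  rw [← cfc_mul _ _ _ (continuousOn_spectrum _ _) (continuousOn_spectrum _ _)]
  conv_rhs => rw [← cfc_id' ℝ D hD.isHermitian]
  exact cfc_congr fun x hx => Real.mul_self_sqrt (spectrum_nonneg_of_nonneg hD.nonneg hx)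

lemma isHermitian_sqrt {D : Matrix m m ℂ} (hD : D.PosSemidef) : (CFC.sqrt D)ᴴ = CFC.sqrt D := by
  rw [sqrt_eq_cfc_real hD]
  exact cfc_predicate Real.sqrt D

lemma isHermitian_invSqrt (D : Matrix m m ℂ) : (invSqrt D)ᴴ = invSqrt D :=
  cfc_predicate (p := IsSelfAdjoint) (fun x : ℝ => (Real.sqrt x)⁻¹) D

lemma sqrt_mul_sqrt {D : Matrix m m ℂ} (hD : D.PosSemidef) : CFC.sqrt D * CFC.sqrt D = D :=
  CFC.sqrt_mul_sqrt_self D hD.nonneg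

lemma suppProj_mul_sqrt {D : Matrix m m ℂ} (hD : D.PosSemidef) :
    suppProj D * CFC.sqrt D = CFC.sqrt D := by
  rw [sqrt_eq_cfc_real hD, suppProj,
    ← cfc_mul _ _ _ (continuousOn_spectrum _ _) (continuousOn_spectrum _ _)]
  refine cfc_congr fun x _ => ?_
  by_cases h : x = 0 <;> simp [h]

lemma invSqrt_mul_mul_invSqrt {D : Matrix m m ℂ} (hD : D.PosSemidef) :
    invSqrt D * D * invSqrt D = suppProj D := by
  have h : invSqrt D * D = cfc (fun x : ℝ => (Real.sqrt x)⁻¹ * x) D := by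
    have hid : cfc (fun x : ℝ => x) D = D := cfc_id' ℝ D hD.isHermitian
    refine Eq.trans ?_ (cfc_mul (fun x : ℝ => (Real.sqrt x)⁻¹) (fun x => x) D
      (continuousOn_spectrum _ _) (continuousOn_spectrum _ _)).symm
    rw [hid, invSqrt]
  rw [h, invSqrt, suppProj, ← cfc_mul _ _ _ (continuousOn_spectrum _ _) (continuousOn_spectrum _ _)]
  refine cfc_congr fun x hx => ?_
  have hx0 : 0 ≤ x := spectrum_nonneg_of_nonneg hD.nonneg hx
  -- On the kernel the convention `0⁻¹ = 0` gives the value zero, as the support projector requires.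
  by_cases h : x = 0
  · simp [h]
  · have hs : Real.sqrt x ≠ 0 := (Real.sqrt_pos.mpr (lt_of_le_of_ne hx0 (Ne.symm h))).ne'
    simp only [h, if_false]
    rw [mul_right_comm, ← mul_inv, Real.mul_self_sqrt hx0, inv_mul_cancel₀ h]

lemma invSqrt_smul_one (r : ℝ) : invSqrt (((r : ℝ) : ℂ) • (1 : Matrix m m ℂ)) =
    (((Real.sqrt r)⁻¹ : ℝ) : ℂ) • (1 : Matrix m m ℂ) := by
  have e : ∀ c : ℝ, ((c : ℝ) : ℂ) • (1 : Matrix m m ℂ) = algebraMap ℝ (Matrix m m ℂ) c := by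
    intro c
    rw [Algebra.algebraMap_eq_smul_one]
    exact (RCLike.real_smul_eq_coe_smul (K := ℂ) c (1 : Matrix m m ℂ)).symm
  rw [e, e, invSqrt, cfc_algebraMap]

lemma sqrt_smul_one {r : ℝ} (hr : 0 ≤ r) : CFC.sqrt (((r : ℝ) : ℂ) • (1 : Matrix m m ℂ)) =
    ((Real.sqrt r : ℝ) : ℂ) • (1 : Matrix m m ℂ) := by
  refine CFC.sqrt_unique ?_ ?_
  · rw [smul_mul_smul_comm, Matrix.one_mul, ← Complex.ofReal_mul, Real.mul_self_sqrt hr]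
  · exact (PosSemidef.one.smul (Complex.zero_le_real.mpr (Real.sqrt_nonneg _))).nonneg

end FunctionalCalculus

/-! ### The isometries of the optimal comb -/

section Isometries

/-- The maximally entangled ket bends the output leg of `K` into an input index, so the entries of a
tooth isometry are those of `K` rearranged. -/
lemma kronecker_mul_copyKet_apply {o s : Type*} [Fintype o] [DecidableEq o] [Fintype s]
    [DecidableEq s] (K : Matrix (o × s) (o × s) ℂ) (a : o) (w : o × s) (y : s) :
    (((1 : Matrix o o ℂ) ⊗ₖ K) * copyKet o s) (a, w) y = K w (a, y) := by
  simp only [mul_apply, kroneckerMap_apply, copyKet, of_apply, Fintype.sum_prod_type, one_apply,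
    ite_and, mul_ite, mul_one, mul_zero, ite_mul, one_mul, zero_mul]
  simp

variable {d : ℕ}

lemma posSemidef_conjM_optimalComb (hd : 2 ≤ d) : (conjM (optimalComb d)).PosSemidef :=
  PosSemidef.conjM (posSemidef_optimalComb hd)

lemma inv_natCast_eq_ofReal (d : ℕ) : (d : ℂ)⁻¹ = (((d : ℝ)⁻¹ : ℝ) : ℂ) := by
  push_cast
  rfl

lemma isometryOne_eq (hd : 2 ≤ d) :
    isometryOne d = ((Real.sqrt d : ℝ) : ℂ)⁻¹ • copyKet (Fin d) (Fin d) := by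
  have h1 : invSqrt (conjM (1 : Matrix (Fin d) (Fin d) ℂ)) = 1 := by
    have h := conjM_smul_one (m := Fin d) 1
    have h2 := invSqrt_smul_one (m := Fin d) 1
    simp only [Complex.ofReal_one, one_smul, Real.sqrt_one, inv_one] at h h2
    rw [h, h2]
  rw [isometryOne, toothIsometry, reducedComb_optimalComb hd, h1, one_kronecker_one,
    Matrix.mul_one, inv_natCast_eq_ofReal, conjM_smul_one, sqrt_smul_one (by positivity),
    kronecker_smul, one_kronecker_one, Matrix.smul_mul, Matrix.one_mul, Real.sqrt_inv,
    Complex.ofReal_inv]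

lemma isometryTwo_eq (hd : 2 ≤ d) : isometryTwo d = ((Real.sqrt d : ℝ) : ℂ) •
    (((1 : Matrix (Fin d) (Fin d) ℂ) ⊗ₖ CFC.sqrt (conjM (optimalComb d))) *
      copyKet (Fin d) (Fin d × (Fin d × Fin d))) := by
  rw [isometryTwo, toothIsometry, reducedComb_optimalComb hd, kronecker_smul, one_kronecker_one,
    inv_natCast_eq_ofReal, conjM_smul_one, invSqrt_smul_one, kronecker_smul, one_kronecker_one,
    Matrix.mul_smul, Matrix.mul_one, kronecker_smul, Matrix.smul_mul, Real.sqrt_inv, inv_inv]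

lemma isometryTwo_apply (hd : 2 ≤ d) (a : Fin d) (w : Wires d) (y : Fin d × Fin d × Fin d) :
    isometryTwo d (a, w) y =
      ((Real.sqrt d : ℝ) : ℂ) * CFC.sqrt (conjM (optimalComb d)) w (a, y) := by
  rw [isometryTwo_eq hd, Matrix.smul_apply, kronecker_mul_copyKet_apply, smul_eq_mul]

lemma sqrt_mul_sqrt_natCast (d : ℕ) :
    ((Real.sqrt d : ℝ) : ℂ) * ((Real.sqrt d : ℝ) : ℂ) = d := by
  rw [← Complex.ofReal_mul, Real.mul_self_sqrt (Nat.cast_nonneg d), Complex.ofReal_natCast]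

lemma sum_star_sqrt_mul_sqrt {m : Type*} [Fintype m] [DecidableEq m] {D : Matrix m m ℂ}
    (hD : D.PosSemidef) (i j : m) : ∑ w, star (CFC.sqrt D w i) * CFC.sqrt D w j = D i j := by
  have h : (CFC.sqrt D)ᴴ * CFC.sqrt D = D := by rw [isHermitian_sqrt hD, sqrt_mul_sqrt hD]
  exact entry_eq h i j

lemma isometryOne_isometry (hd : 2 ≤ d) : (isometryOne d)ᴴ * isometryOne d = 1 := by
  have h0 : (d : ℂ) ≠ 0 := Nat.cast_ne_zero.mpr (by omega)
  have h : (copyKet (Fin d) (Fin d))ᴴ * copyKet (Fin d) (Fin d) =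
      (d : ℂ) • (1 : Matrix (Fin d) (Fin d) ℂ) := by
    ext i j
    by_cases h : i = j
    · simp [mul_apply, copyKet, Fintype.sum_prod_type, ite_and, h]
    · simp [mul_apply, copyKet, Fintype.sum_prod_type, ite_and, h, Ne.symm h]
  rw [isometryOne_eq hd, conjTranspose_smul, Matrix.smul_mul, Matrix.mul_smul, h, smul_smul,
    smul_smul, star_inv₀, Complex.star_def, Complex.conj_ofReal, ← mul_inv, sqrt_mul_sqrt_natCast,
    inv_mul_cancel₀ h0, one_smul]

/-- Summing over the ancilla turns the two square roots into `C^*`, so `V† V` is `d` times the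
conjugate of `Tr_3 C`, which is the identity. -/
lemma isometryTwo_isometry (hd : 2 ≤ d) : (isometryTwo d)ᴴ * isometryTwo d = 1 := by
  have h0 : (d : ℂ) ≠ 0 := Nat.cast_ne_zero.mpr (by omega)
  ext y y'
  have h1 : ((isometryTwo d)ᴴ * isometryTwo d) y y' =
      d * ∑ a, conjM (optimalComb d) (a, y) (a, y') := by
    rw [mul_apply, Fintype.sum_prod_type, Finset.mul_sum]
    refine Finset.sum_congr rfl fun a _ => ?_
    rw [← sum_star_sqrt_mul_sqrt (posSemidef_conjM_optimalComb hd), Finset.mul_sum]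
    refine Finset.sum_congr rfl fun w _ => ?_
    rw [conjTranspose_apply, isometryTwo_apply hd, isometryTwo_apply hd, star_mul',
      Complex.star_def, Complex.conj_ofReal, ← sqrt_mul_sqrt_natCast d]
    ring
  have h2 : ∑ a, conjM (optimalComb d) (a, y) (a, y') =
      star (traceLeft (optimalComb d) y y') := by
    rw [traceLeft_apply, star_sum]
    rfl
  rw [h1, h2, traceLeft_optimalComb hd, kronecker_smul, one_kronecker_one, Matrix.smul_apply,
    smul_eq_mul, star_mul', star_inv₀, star_natCast, mul_inv_cancel_left₀ h0]
  by_cases h : y = y'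
  · rw [h, one_apply_eq, star_one]
  · rw [one_apply_ne h, star_zero]

lemma suppProj_mul_isometryTwo (hd : 2 ≤ d) :
    ((1 : Matrix (Fin d) (Fin d) ℂ) ⊗ₖ suppProj (conjM (optimalComb d))) * isometryTwo d =
      isometryTwo d := by
  rw [isometryTwo_eq hd, Matrix.mul_smul, ← Matrix.mul_assoc, ← mul_kronecker_mul, Matrix.one_mul,
    suppProj_mul_sqrt (posSemidef_conjM_optimalComb hd)]

lemma choi_apply {m n : Type*} [Fintype m] [DecidableEq m] (Φ : Matrix m m ℂ → Matrix n n ℂ)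
    (x y : n) (i j : m) : choi Φ (x, i) (y, j) = Φ (single i j 1) x y := by
  simp only [choi, Matrix.sum_apply, kroneckerMap_apply]
  simp [single_apply, ite_and]

lemma dilated_single_apply {m n a : Type*} [Fintype m] [DecidableEq m] [Fintype a]
    (V : Matrix (n × a) m ℂ) (i j : m) (x y : n) :
    dilated V (single i j 1) x y = ∑ w, V (x, w) i * star (V (y, w) j) := by
  simp only [dilated, traceRight_apply]
  refine Finset.sum_congr rfl fun w _ => ?_
  simp [mul_apply, single_apply, ite_and]

lemma concat_apply (hd : 2 ≤ d) (w : Wires d) (x y : Fin d × Fin d) :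
    concat (isometryTwo d) (isometryOne d) (x, w) y =
      CFC.sqrt (conjM (optimalComb d)) w (x.1, y.1, x.2, y.2) := by
  have hs : ((Real.sqrt d : ℝ) : ℂ) ≠ 0 := by
    rw [Complex.ofReal_ne_zero]
    exact (Real.sqrt_pos.mpr (by exact_mod_cast (by omega : 0 < d))).ne'
  simp only [concat, of_apply, isometryTwo_apply hd, isometryOne_eq hd, Matrix.smul_apply, copyKet,
    Fintype.sum_prod_type, smul_eq_mul, ite_and, mul_ite, mul_one, mul_zero]
  simp only [Finset.sum_ite_irrel, Finset.sum_const_zero, Finset.sum_ite_eq, Finset.sum_ite_eq',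
    Finset.mem_univ, if_true]
  field_simp

/-- The factors `√d` and `1/√d` of the two isometries cancel, and the network is the canonical
purification of `C^*`. Tracing out the ancilla gives the entry `(v, w)` of `C^*`, which is the entry
`(w, v)` of `C` conjugated, hence `C w v`. -/
lemma optimalComb_eq_choi (hd : 2 ≤ d) :
    optimalComb d = (choi (dilated (concat (isometryTwo d) (isometryOne d)))).submatrix
      (group3120 d) (group3120 d) := by
  ext w v
  rw [submatrix_apply, ← Prod.mk.eta (p := group3120 d w), ← Prod.mk.eta (p := group3120 d v),
    choi_apply, dilated_single_apply]
  simp only [concat_apply hd, group3120, Equiv.coe_fn_mk, Prod.mk.eta]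
  simp only [mul_comm _ (star _)]
  rw [sum_star_sqrt_mul_sqrt (posSemidef_conjM_optimalComb hd)]
  exact (entry_eq (posSemidef_optimalComb hd).isHermitian.eq w v).symm

lemma dilated_isometryTwo_apply (hd : 2 ≤ d)
    (ρ : Matrix (Fin d × (Fin d × Fin d)) (Fin d × (Fin d × Fin d)) ℂ) (a b : Fin d) :
    dilated (isometryTwo d) ρ a b =
      d * ∑ s, ∑ s', ρ s s' * conjM (optimalComb d) (b, s') (a, s) := by
  simp only [dilated, traceRight_apply, mul_apply, conjTranspose_apply, isometryTwo_apply hd,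
    ← sum_star_sqrt_mul_sqrt (posSemidef_conjM_optimalComb hd), Finset.mul_sum, Finset.sum_mul]
  rw [Finset.sum_comm]
  conv_rhs => rw [Finset.sum_comm]
  refine Finset.sum_congr rfl fun s' _ => ?_
  rw [Finset.sum_comm]
  refine Finset.sum_congr rfl fun s _ => Finset.sum_congr rfl fun w _ => ?_
  rw [star_mul', Complex.star_def, Complex.conj_ofReal, ← sqrt_mul_sqrt_natCast d]
  ring

end Isometries

/-! ### The measure-and-reprepare channel -/

section MeasureReprepare

variable {d : ℕ}

lemma conjM_optimalComb (hd : 2 ≤ d) :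
    conjM (optimalComb d) = haarAvg fun U : SU d => conjM (combProj U) := by
  rw [← haarAvg_combProj hd, conjM_haarAvg]

lemma conjM_combProj (U : SU d) :
    conjM (combProj U) = tensor3021 (dproj U.1.transpose) (dproj U.1) := by
  ext w v
  simp [conjM, combProj, tensor3021, dproj, dket, vecMulVec_apply]

lemma continuous_conjM_combProj : Continuous fun U : SU d => conjM (combProj U) :=
  continuous_conjM continuous_combProj

lemma ancillaPOVM_eq (U : SU d) : ancillaPOVM U =
    invSqrt (conjM (optimalComb d)) * conjM (combProj U) * invSqrt (conjM (optimalComb d)) := by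
  rw [conjM_combProj]
  rfl

lemma posSemidef_ancillaPOVM (U : SU d) : (ancillaPOVM U).PosSemidef := by
  rw [ancillaPOVM_eq]
  have h := (PosSemidef.conjM (posSemidef_combProj U)).mul_mul_conjTranspose_same
    (invSqrt (conjM (optimalComb d)))
  rwa [isHermitian_invSqrt] at h

lemma haarAvg_ancillaPOVM (hd : 2 ≤ d) :
    haarAvg (fun U : SU d => ancillaPOVM U) = suppProj (conjM (optimalComb d)) := by
  simp only [ancillaPOVM_eq]
  rw [← mul_haarAvg_mul _ _ continuous_conjM_combProj, ← conjM_optimalComb hd,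
    invSqrt_mul_mul_invSqrt (posSemidef_conjM_optimalComb hd)]

lemma continuous_ancillaPOVM : Continuous fun U : SU d => ancillaPOVM U := by
  simp only [ancillaPOVM_eq]
  exact (continuous_const.matrix_mul continuous_conjM_combProj).matrix_mul continuous_const

lemma posSemidef_estimationPOVM (U : SU d) : (estimationPOVM U).PosSemidef :=
  (posSemidef_vecMulVec_self_star _).smul (by positivity)

/-- This is the orthogonality relation for the entries of `U`, read off from `Tr_3` of `Ω` at a
fixed index of wire `0`. -/
lemma haarAvg_estimationPOVM (hd : 2 ≤ d) : haarAvg (fun U : SU d => estimationPOVM U) = 1 := by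
  let r : Fin d := ⟨0, by omega⟩
  have h0 : (d : ℂ) ≠ 0 := Nat.cast_ne_zero.mpr (by omega)
  have h1 := map_haarAvg (traceLeftLin (Fin d) (Fin d × Fin d × Fin d))
    (continuous_combProj (d := d))
  rw [haarAvg_combProj hd] at h1
  ext ⟨b, c⟩ ⟨b', c'⟩
  have h2 := entry_eq h1 (b', c', r) (b, c, r)
  simp only [traceLeftLin, LinearMap.coe_mk, AddHom.coe_mk, traceLeft_optimalComb hd,
    haarAvg_apply, traceLeft_combProj, one_apply_eq, mul_one] at h2
  simp only [haarAvg_apply, estimationPOVM, Matrix.smul_apply, dproj, vecMulVec_apply,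
    Pi.star_apply, dket, smul_eq_mul, integral_const_mul]
  simp only [mul_comm (_ : ℂ) (star _)]
  rw [← h2]
  simp only [kroneckerMap_apply, Matrix.smul_apply, one_apply, Prod.mk.injEq, smul_eq_mul, and_true,
    ite_and, eq_comm (a := b'), eq_comm (a := c')]
  split_ifs <;> simp [h0]

lemma traceRight_mul_one_kronecker_comm {m n : Type*} [Fintype m] [DecidableEq m] [Fintype n]
    (A : Matrix (m × n) (m × n) ℂ) (B : Matrix n n ℂ) :
    traceRight (A * ((1 : Matrix m m ℂ) ⊗ₖ B)) = traceRight (((1 : Matrix m m ℂ) ⊗ₖ B) * A) := by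
  ext x y
  simp only [traceRight_apply, mul_one_kronecker_apply, one_kronecker_mul_apply]
  rw [Finset.sum_comm]
  refine Finset.sum_congr rfl fun _ _ => Finset.sum_congr rfl fun _ _ => mul_comm _ _

/-- The POVM integrates to the support projector, which cyclicity over the ancilla moves next to the
isometry; there it acts trivially. -/
lemma dilated_isometryTwo_eq_ancilla (hd : 2 ≤ d)
    (ρ : Matrix (Fin d × (Fin d × Fin d)) (Fin d × (Fin d × Fin d)) ℂ) :
    dilated (isometryTwo d) ρ = haarAvg (fun U : SU d =>
        traceRight (isometryTwo d * ρ * (isometryTwo d).conjTranspose *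
          ((1 : Matrix (Fin d) (Fin d) ℂ) ⊗ₖ ancillaPOVM U))) := by
  set A := isometryTwo d * ρ * (isometryTwo d)ᴴ with hA
  have h := map_haarAvg ((traceRightLin (Fin d) (Wires d)).comp
    ((mulMulLin A 1).comp (oneKroneckerLin (Fin d) (Wires d)))) (continuous_ancillaPOVM (d := d))
  simp only [LinearMap.comp_apply, traceRightLin, mulMulLin, oneKroneckerLin, LinearMap.coe_mk,
    AddHom.coe_mk, Matrix.mul_one] at h
  rw [← h, haarAvg_ancillaPOVM hd, traceRight_mul_one_kronecker_comm, hA, ← Matrix.mul_assoc,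
    ← Matrix.mul_assoc, suppProj_mul_isometryTwo hd]
  rfl

lemma dilated_isometryTwo_eq_reprepare (hd : 2 ≤ d)
    (ρ : Matrix (Fin d × (Fin d × Fin d)) (Fin d × (Fin d × Fin d)) ℂ) :
    dilated (isometryTwo d) ρ = haarAvg (fun U : SU d =>
        (d : ℂ) • (U.1.conjTranspose *
          ((dketTensorId U).conjTranspose * ρ * dketTensorId U) * U.1)) := by
  -- The channel output depends linearly on `C^*`, so the Haar decomposition of `C^*` passes through
  -- it and the identity is checked for each `U`.
  let G : Matrix (Wires d) (Wires d) ℂ →ₗ[ℂ] Matrix (Fin d) (Fin d) ℂ :=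
    { toFun := fun X => of fun a b => (d : ℂ) * ∑ s, ∑ s', ρ s s' * X (b, s') (a, s)
      map_add' := fun X Y => by
        ext a b
        simp [mul_add, Finset.sum_add_distrib]
      map_smul' := fun c X => by
        ext a b
        simp only [of_apply, Matrix.smul_apply, smul_eq_mul, RingHom.id_apply, Finset.mul_sum]
        refine Finset.sum_congr rfl fun _ _ => Finset.sum_congr rfl fun _ _ => ?_
        ring }
  have h1 : dilated (isometryTwo d) ρ = G (conjM (optimalComb d)) := by
    ext a b
    exact dilated_isometryTwo_apply hd ρ a b
  rw [h1, conjM_optimalComb hd, map_haarAvg G continuous_conjM_combProj]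
  refine congrArg haarAvg (funext fun U => ?_)
  have hK : ∀ s a, (dketTensorId U * U.1) s a = U.1 s.1 s.2.1 * U.1 s.2.2 a := by
    intro s a
    simp [mul_apply, dketTensorId, dket, one_apply]
  have h2 : U.1ᴴ * ((dketTensorId U)ᴴ * ρ * dketTensorId U) * U.1 =
      (dketTensorId U * U.1)ᴴ * ρ * (dketTensorId U * U.1) := by
    rw [conjTranspose_mul]
    simp only [Matrix.mul_assoc]
  rw [h2]
  ext a b
  simp only [G, LinearMap.coe_mk, AddHom.coe_mk, of_apply, Matrix.smul_apply, smul_eq_mul]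
  congr 1
  -- Only the entries of `K` matter: they are the conjugates of those of `combKet`, so both sides
  -- are entries of `K† ρ K`.
  generalize dketTensorId U * U.1 = K at hK
  simp only [Matrix.mul_apply, conjTranspose_apply, hK, Finset.sum_mul, conjM, map_apply,
    combProj_eq_vecMulVec, vecMulVec_apply, Pi.star_apply, combKet_apply, star_mul', star_star]
  rw [Finset.sum_comm]
  refine Finset.sum_congr rfl fun _ _ => Finset.sum_congr rfl fun _ _ => ?_
  ring

lemma measureAndReprepare_eq
    (ρ : Matrix (Fin d × (Fin d × Fin d)) (Fin d × (Fin d × Fin d)) ℂ) :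
    measureAndReprepare ρ = haarAvg (fun U : SU d =>
        (d : ℂ) • (U.1.conjTranspose *
          ((dketTensorId U).conjTranspose * ρ * dketTensorId U) * U.1)) := by
  refine congrArg haarAvg (funext fun U => ?_)
  rw [← Matrix.smul_mul, ← Matrix.mul_smul]
  congr 2
  ext x y
  simp only [traceLeft_apply, mul_apply, submatrix_apply, kroneckerMap_apply, Matrix.smul_apply,
    smul_eq_mul, conjTranspose_apply, dketTensorId, of_apply, Fintype.sum_prod_type, one_apply,
    Equiv.prodAssoc_symm_apply, estimationPOVM, dproj, vecMulVec_apply, Pi.star_apply, dket,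
    mul_ite, mul_one, mul_zero, ite_mul, zero_mul, Finset.sum_ite_eq, Finset.sum_ite_eq',
    Finset.mem_univ, if_true, apply_ite star, star_zero, Finset.mul_sum, Finset.sum_mul]
  rw [Finset.sum_comm]
  refine Finset.sum_congr rfl fun _ _ => Finset.sum_congr rfl fun _ _ =>
    Finset.sum_congr rfl fun _ _ => Finset.sum_congr rfl fun _ _ => ?_
  ring

lemma probeAfter_eq (U : SU d) : probeAfter U = (d : ℂ)⁻¹ • dproj U.1 := by
  rw [probeAfter, Matrix.mul_smul, Matrix.smul_mul, kronecker_conj_dproj, transpose_one,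
    Matrix.mul_one, Matrix.mul_one]

lemma trace_estimationPOVM_mul_probeAfter (hd : d ≠ 0) (U V : SU d) :
    (estimationPOVM V * probeAfter U).trace =
      (star (dket V.1) ⬝ᵥ dket U.1) * (star (dket U.1) ⬝ᵥ dket V.1) := by
  rw [probeAfter_eq, estimationPOVM, smul_mul_smul_comm,
    mul_inv_cancel₀ (Nat.cast_ne_zero.mpr hd), one_smul, dproj, dproj, vecMulVec_mul_vecMulVec,
    vecMulVec_smul, trace_smul, trace_vecMulVec, smul_eq_mul, dotProduct_comm (dket V.1)]

/-- Insertion of `U` is linear in the comb. For the term of the estimate `V`, the contraction over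
`21` gives the outcome density `|⟨⟨V|U⟩⟩|²` and the factor on `30` is the Choi operator of
conjugation by `V†`. -/
lemma plug_optimalComb (hd : 2 ≤ d) (U : SU d) :
    plug (optimalComb d) (dproj U.1) = choi (estimateAndReprepare U) := by
  ext a b
  let G : Matrix (Wires d) (Wires d) ℂ →ₗ[ℂ] ℂ :=
    { toFun := fun X => plug X (dproj U.1) a b
      map_add' := fun X Y => by
        simp [plug_apply, add_mul, Finset.sum_add_distrib]
      map_smul' := fun c X => by
        simp [plug_apply, mul_assoc, Finset.mul_sum] }
  have h := functional_haarAvg G (continuous_combProj (d := d))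
  rw [haarAvg_combProj hd] at h
  refine h.trans ?_
  rw [← Prod.mk.eta (p := a), ← Prod.mk.eta (p := b), choi_apply, estimateAndReprepare,
    haarAvg_apply]
  refine integral_congr_ae (Filter.Eventually.of_forall fun V => ?_)
  have hV : (V.1ᴴ * single a.2 b.2 (1 : ℂ) * V.1 : Matrix (Fin d) (Fin d) ℂ) a.1 b.1 =
      star (V.1 a.2 a.1) * V.1 b.2 b.1 := by
    simp [mul_apply, single_apply, ite_and]
  simp only [G, LinearMap.coe_mk, AddHom.coe_mk, Matrix.smul_apply, smul_eq_mul, hV,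
    trace_estimationPOVM_mul_probeAfter (by omega : d ≠ 0), plug_apply, combProj_eq_vecMulVec,
    vecMulVec_apply, Pi.star_apply, combKet_apply, dproj, dket, dotProduct, star_mul', star_star,
    Finset.sum_mul, Finset.mul_sum]
  refine Finset.sum_congr rfl fun _ _ => Finset.sum_congr rfl fun _ _ => ?_
  ring

end MeasureReprepare

end UnitaryInversion

/-! ### Assembly: optimality, uniqueness and realization -/

theorem mainTheorem2 (d : ℕ) (hd : 2 ≤ d) :
    -- the maximal average fidelity over all one-slot combs is `2 / d ^ 2`
    (∀ C : Matrix (Wires d) (Wires d) ℂ, IsOneSlotComb C →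
      MeasureTheory.Integrable (fun U : SU d => inversionFidelity C U) (haarSU d)) ∧
    IsGreatest {F : ℝ | ∃ C : Matrix (Wires d) (Wires d) ℂ,
      IsOneSlotComb C ∧ averageFidelity C = F} (2 / (d : ℝ) ^ 2) ∧
    -- covariance can be assumed without loss of generality
    (∀ C : Matrix (Wires d) (Wires d) ℂ, IsOneSlotComb C →
      IsOneSlotComb (twirl C) ∧ IsCovariant (twirl C) ∧
        averageFidelity (twirl C) = averageFidelity C) ∧
    -- the optimal comb, and the characterization of optimality
    IsOneSlotComb (optimalComb d) ∧ IsCovariant (optimalComb d) ∧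
    (∀ C : Matrix (Wires d) (Wires d) ℂ, IsOneSlotComb C → IsCovariant C →
      (averageFidelity C = 2 / (d : ℝ) ^ 2 ↔ C = optimalComb d)) ∧
    (∀ C : Matrix (Wires d) (Wires d) ℂ, IsOneSlotComb C →
      (averageFidelity C = 2 / (d : ℝ) ^ 2 ↔ twirl C = optimalComb d)) ∧
    optimalComb d = haarAvg (fun U : SU d =>
      tensor3021 (dproj U.1.conjTranspose) (dproj (conjM U.1))) ∧
    -- the two isometries, and the network that they form
    traceLeft (optimalComb d) =
      (1 : Matrix (Fin d) (Fin d) ℂ) ⊗ₖ reducedComb (optimalComb d) ∧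
    reducedComb (optimalComb d) = (d : ℂ)⁻¹ • 1 ∧
    isometryOne d = ((Real.sqrt d : ℝ) : ℂ)⁻¹ • copyKet (Fin d) (Fin d) ∧
    isometryTwo d = ((Real.sqrt d : ℝ) : ℂ) •
      (((1 : Matrix (Fin d) (Fin d) ℂ) ⊗ₖ CFC.sqrt (conjM (optimalComb d))) *
        copyKet (Fin d) (Fin d × (Fin d × Fin d))) ∧
    (isometryOne d).conjTranspose * isometryOne d = 1 ∧
    (isometryTwo d).conjTranspose * isometryTwo d = 1 ∧
    ((1 : Matrix (Fin d) (Fin d) ℂ) ⊗ₖ suppProj (conjM (optimalComb d))) * isometryTwo d =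
      isometryTwo d ∧
    optimalComb d = (choi (dilated (concat (isometryTwo d) (isometryOne d)))).submatrix
      (group3120 d) (group3120 d) ∧
    -- the second isometry dilates a measure-and-reprepare channel
    (∀ U : SU d, (ancillaPOVM U).PosSemidef) ∧
    haarAvg (fun U : SU d => ancillaPOVM U) = suppProj (conjM (optimalComb d)) ∧
    (∀ U : SU d, (estimationPOVM U).PosSemidef) ∧
    haarAvg (fun U : SU d => estimationPOVM U) = 1 ∧
    (∀ ρ : Matrix (Fin d × (Fin d × Fin d)) (Fin d × (Fin d × Fin d)) ℂ,
      dilated (isometryTwo d) ρ = haarAvg (fun U : SU d =>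
        traceRight (isometryTwo d * ρ * (isometryTwo d).conjTranspose *
          ((1 : Matrix (Fin d) (Fin d) ℂ) ⊗ₖ ancillaPOVM U))) ∧
      dilated (isometryTwo d) ρ = haarAvg (fun U : SU d =>
        (d : ℂ) • (U.1.conjTranspose *
          ((dketTensorId U).conjTranspose * ρ * dketTensorId U) * U.1)) ∧
      dilated (isometryTwo d) ρ = measureAndReprepare ρ) ∧
    -- with `U` in its slot, the optimal comb acts as the estimate-and-reprepare strategy
    (∀ U : SU d, plug (optimalComb d) (dproj U.1) = choi (estimateAndReprepare U)) := by
  have h0 : d ≠ 0 := by omega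
  -- The twirl is a covariant comb of the same average fidelity, so the covariant bound holds for
  -- every comb.
  have hle : ∀ C : Matrix (Wires d) (Wires d) ℂ, IsOneSlotComb C →
      averageFidelity C ≤ 2 / (d : ℝ) ^ 2 := fun C hC =>
    averageFidelity_twirl hd hC ▸ averageFidelity_le_of_isCovariant hd (hC.twirl h0)
      (isCovariant_twirl C)
  refine ⟨fun C hC => integrable_inversionFidelity h0 hC.1,
    ⟨⟨optimalComb d, isOneSlotComb_optimalComb hd, averageFidelity_optimalComb hd⟩, ?_⟩,
    fun C hC => ⟨hC.twirl h0, isCovariant_twirl C, averageFidelity_twirl hd hC⟩,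
    isOneSlotComb_optimalComb hd, isCovariant_optimalComb hd,
    fun C hC hcov => averageFidelity_eq_iff_of_isCovariant hd hC hcov, fun C hC => ?_,
    (haarAvg_combProj hd).symm, ?_, reducedComb_optimalComb hd, isometryOne_eq hd,
    isometryTwo_eq hd, isometryOne_isometry hd, isometryTwo_isometry hd,
    suppProj_mul_isometryTwo hd, optimalComb_eq_choi hd, posSemidef_ancillaPOVM,
    haarAvg_ancillaPOVM hd, posSemidef_estimationPOVM, haarAvg_estimationPOVM hd,
    fun ρ => ⟨dilated_isometryTwo_eq_ancilla hd ρ, dilated_isometryTwo_eq_reprepare hd ρ,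
      (dilated_isometryTwo_eq_reprepare hd ρ).trans (measureAndReprepare_eq ρ).symm⟩,
    plug_optimalComb hd⟩
  · rintro F ⟨C, hC, rfl⟩
    exact hle C hC
  · rw [← averageFidelity_twirl hd hC]
    exact averageFidelity_eq_iff_of_isCovariant hd (hC.twirl h0) (isCovariant_twirl C)
  · rw [traceLeft_optimalComb hd, reducedComb_optimalComb hd]
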